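/- Let $d\ge 1$, write $\mathbb R_+=[0,\infty)$, let $B\in\mathbb R^{d\times d}$ have columns $b_1,\dots,b_d$, let $\mu:\mathbb R_+\times\mathbb R^d\to\mathbb R^d$ be measurable, and let $\nu_1(\lambda,dx),\dots,\nu_d(\lambda,dx)$ be probability kernels from $\mathbb R^d$ to $\mathbb R$. On a measurable space with a filtration $(\mathcal F_t)_{t\ge0}$ let there be given stopping times $T_0=0\le T_1\le T_2\le\cdots\le\infty$, types $X_n\in\{1,\dots,d\}$ and non-negative jump sizes $Y^k_n$, where the event $\{T_n\le t,\,X_n=k,\,Y_n^k\in A\}$ lies in $\mathcal F_t$ for all $n\ge1$, $k$, $t$ and all Borel sets $A$, and an adapted càdlàg process $\lambda(t)\in\mathbb R^d$. Put $$N_k(t)=\sum_{n\ge1}1_{\{X_n=k,\,T_n\le t\}},\qquad U_k(t)=\sum_{n\ge1}Y^k_n1_{\{X_n=k,\,T_n\le t\}}.$$ Let $S\subseteq\mathbb R_+^d$ be a set of initial states, and for every $\lambda\in S$ let $\mathbb P_\lambda$ be a probability measure (with expectation $\mathbb E_\lambda$) under which, almost surely, $T_n<T_{n+1}$ whenever $T_n<\infty$,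 $T_n\to\infty$, $\lambda(t)\in\mathbb R_+^d$ for all $t$, $\lambda(0)=\lambda$, the function $s\mapsto\mu(s,\lambda(s))$ is integrable on bounded intervals, and $$\lambda(t)=\lambda(0)+\int_0^t\mu(s,\lambda(s))\,ds+B\,U(t)\qquad(t\ge0);$$ under which $\lambda_k$ is the intensity of $N_k$, i.e. $\mathbb E_\lambda\int_0^\infty H(s)\,N_k(ds)=\mathbb E_\lambda\int_0^\infty H(s)\lambda_k(s)\,ds$ for every predictable $H\ge0$ and every $k$; and under which, for all $n\ge1$ and $k$, the conditional law of $Y_n^k$ given $\mathcal F_{T_n-}$ and given that $X_n=k$, $T_n<\infty$, is $\nu_k(\lambda(T_n-),\cdot)$. The domain $\mathcal D(\mathcal A)$ of the extended generator of $\lambda(t)$ consists of the measurable functions $f:\mathbb R^d\to\mathbb R$ for which there is a measurable $\psi=:\mathcal Af$ such that, for every $\lambda\in S$, $\mathbb P_\lambda$-almost surely $s\mapsto\psi(\lambda(s))$ is integrable on bounded intervals, and $$C_f(t)=f(\lambda(t))-f(\lambda(0))-\int_0^t\psi(\lambda(s))\,ds$$ is a local martingale under $\mathbb P_\lambda$ with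 respect to the filtration $\sigma\{\lambda(s):s\le t\}$. If $\mu$ depends on time, $\psi(\lambda(s))$ is replaced by $\psi(s,\lambda(s))$. **Proposition.** Let $f:\mathbb R^d\to\mathbb R$ be measurable and continuously differentiable on $\mathbb R_+^d$ (one-sidedly at the boundary). Suppose that $\lambda\mapsto\int f(\lambda+b_kx)\,\nu_k(\lambda,dx)$ is measurable for $k=1,\dots,d$, and that $$\mathbb E_\lambda\Big[\int_0^t\sum_{k=1}^d\lambda_k(s)\int\big|f(\lambda(s-)+b_kx)-f(\lambda(s-))\big|\,\nu_k(\lambda(s-),dx)\,ds\Big]<\infty$$ for all $t>0$ and all $\lambda\in S$. Then $f$ is in the domain of the extended generator of $\lambda(t)$, and $$\mathcal Af(\lambda)=\langle\mu(\cdot,\lambda),\nabla f(\lambda)\rangle+\sum_{k=1}^d\lambda_k\int\big(f(\lambda+b_kx)-f(\lambda)\big)\,\nu_k(\lambda,dx).$$ That is, the above holds with $\psi(t,\lambda)=\langle\mu(t,\lambda),\nabla f(\lambda)\rangle+\sum_k\lambda_k\int(f(\lambda+b_kx)-f(\lambda))\,\nu_k(\lambda,dx)$; and if $\mu$ does not depend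 on time, then $\psi$ does not either, so that $f\in\mathcal D(\mathcal A)$ with $\mathcal Af=\psi$. -/

import Mathlib

open MeasureTheory ProbabilityTheory Filter Topology Set
open scoped NNReal ENNReal

namespace SelfExciting

/-- The state space `ℝ₊ᵈ`, as a subset of `ℝᵈ`. -/
def orthant (d : ℕ) : Set (EuclideanSpace ℝ (Fin d)) := {x | ∀ i, 0 ≤ x i}

/-- The `k`-th column `b_k = B e_k` of the matrix `B`. -/
def column {d : ℕ} (B : Matrix (Fin d) (Fin d) ℝ) (k : Fin d) : EuclideanSpace ℝ (Fin d) :=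
  WithLp.toLp 2 (fun j => B j k)

/-- Lebesgue measure `ds` on the time axis `[0, ∞)`. -/
noncomputable def lebesgueTime : Measure ℝ≥0 :=
  (volume : Measure ℝ).comap ((↑) : ℝ≥0 → ℝ)

/-- A path indexed by `[0, ∞)` is càdlàg: right-continuous with (finite) left limits. -/
def IsCadlagPath {E : Type*} [TopologicalSpace E] (g : ℝ≥0 → E) : Prop :=
  ∀ t, ContinuousWithinAt g (Ici t) t ∧ ∃ l, Tendsto g (𝓝[<] t) (𝓝 l)

/-- The strict past `𝓕_{τ-}` of a random time `τ`: it is generated by `𝓕_0` and by the events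
`A ∩ {t < τ}` with `A ∈ 𝓕_t`. -/
@[reducible] def strictPast {Ω : Type*} {m : MeasurableSpace Ω} (𝓕 : Filtration ℝ≥0 m)
    (τ : Ω → WithTop ℝ≥0) : MeasurableSpace Ω :=
  MeasurableSpace.generateFrom
    ({A | MeasurableSet[𝓕 0] A} ∪
      {C | ∃ (t : ℝ≥0) (A : Set Ω), MeasurableSet[𝓕 t] A ∧ C = A ∩ {ω | (t : WithTop ℝ≥0) < τ ω}})

section Events

variable {Ω : Type*} {d : ℕ}

/-- The set of indices `n ≥ 1` (written `n = m + 1`) of the events that are of type `k` and that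
take place at a finite time. A value `T n ω = ⊤` means that there are fewer than `n` events. -/
def eventIndices (T : ℕ → Ω → WithTop ℝ≥0) (X : ℕ → Ω → Fin d) (k : Fin d) (ω : Ω) : Set ℕ :=
  {m | T (m + 1) ω < ⊤ ∧ X (m + 1) ω = k}

open Classical in
/-- The random measure `N_k(ds)` on `[0, ∞)`: a unit mass at every event time of type `k`. -/
noncomputable def counting (T : ℕ → Ω → WithTop ℝ≥0) (X : ℕ → Ω → Fin d) (k : Fin d) (ω : Ω) :
    Measure ℝ≥0 :=
  Measure.sum fun m =>
    if m ∈ eventIndices T X k ω then Measure.dirac ((T (m + 1) ω).untopD 0) else 0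

open Classical in
/-- `U_k(t)`: the sum of the jump sizes of the events of type `k` up to time `t`. -/
noncomputable def jumpSum (T : ℕ → Ω → WithTop ℝ≥0) (X : ℕ → Ω → Fin d) (Y : Fin d → ℕ → Ω → ℝ)
    (k : Fin d) (t : ℝ≥0) (ω : Ω) : ℝ :=
  ∑' m : ℕ, if T (m + 1) ω ≤ t ∧ X (m + 1) ω = k then Y k (m + 1) ω else 0

end Events

/-- Under `P`, the times `T n`, types `X n` and sizes `Y k n` form a multivariate self-exciting jump
process whose intensity is the process `Λ`, started at `x` and driven by the SDE
`dΛ = μ(t, Λ) dt + B dU`, with jump-size distributions `ν k`; `𝓕` is the underlying filtration. -/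
structure IsSelfExciting {Ω : Type*} [m : MeasurableSpace Ω] {d : ℕ}
    (μ : ℝ≥0 → EuclideanSpace ℝ (Fin d) → EuclideanSpace ℝ (Fin d))
    (B : Matrix (Fin d) (Fin d) ℝ) (ν : Fin d → Kernel (EuclideanSpace ℝ (Fin d)) ℝ)
    (𝓕 : Filtration ℝ≥0 m) (T : ℕ → Ω → WithTop ℝ≥0) (X : ℕ → Ω → Fin d)
    (Y : Fin d → ℕ → Ω → ℝ) (Λ : ℝ≥0 → Ω → EuclideanSpace ℝ (Fin d))
    (P : Measure Ω) (x : EuclideanSpace ℝ (Fin d)) : Prop where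
  isProbabilityMeasure : IsProbabilityMeasure P
  /-- The event times start from `T 0 = 0`, increase strictly, and do not accumulate. -/
  time_zero : ∀ᵐ ω ∂P, T 0 ω = 0
  time_mono : ∀ᵐ ω ∂P, Monotone fun n => T n ω
  time_strict : ∀ᵐ ω ∂P, ∀ n, T n ω < ⊤ → T n ω < T (n + 1) ω
  time_tendsto : ∀ᵐ ω ∂P, Tendsto (fun n => T n ω) atTop (𝓝 ⊤)
  /-- The jump sizes are non-negative. -/
  size_nonneg : ∀ᵐ ω ∂P, ∀ k n, 0 ≤ Y k n ω
  /-- Events, their types and their sizes are observed in `𝓕` when they happen. -/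
  time_stopping : ∀ n, IsStoppingTime 𝓕 (T n)
  event_adapted : ∀ (n : ℕ) (k : Fin d) (A : Set ℝ) (t : ℝ≥0), MeasurableSet A →
    MeasurableSet[𝓕 t] {ω | T (n + 1) ω ≤ t ∧ X (n + 1) ω = k ∧ Y k (n + 1) ω ∈ A}
  /-- The intensity is an adapted càdlàg process with values in `ℝ₊ᵈ`, started at `x`. -/
  intensity_adapted : ∀ t, Measurable[𝓕 t] (Λ t)
  intensity_cadlag : ∀ ω, IsCadlagPath fun t => Λ t ω
  intensity_nonneg : ∀ᵐ ω ∂P, ∀ t, Λ t ω ∈ orthant d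
  intensity_zero : ∀ᵐ ω ∂P, Λ 0 ω = x
  /-- The SDE, in integrated form. -/
  drift_integrable : ∀ᵐ ω ∂P, ∀ t, IntegrableOn (fun s => μ s (Λ s ω)) (Iic t) lebesgueTime
  sde : ∀ᵐ ω ∂P, ∀ t, Λ t ω =
    Λ 0 ω + (∫ s in Iic t, μ s (Λ s ω) ∂lebesgueTime) + ∑ k, jumpSum T X Y k t ω • column B k
  /-- The `k`-th coordinate of `Λ` is the `(P, 𝓕)`-intensity of the counting process `N_k`:
  `E ∫ H(s) N_k(ds) = E ∫ H(s) Λ_k(s) ds` for all predictable `H ≥ 0`. -/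
  intensity : ∀ (k : Fin d) (H : ℝ≥0 × Ω → ℝ≥0∞), Measurable[𝓕.predictable] H →
    ∫⁻ ω, ∫⁻ s, H (s, ω) ∂(counting T X k ω) ∂P =
      ∫⁻ ω, ∫⁻ s, H (s, ω) * ENNReal.ofReal (Λ s ω k) ∂lebesgueTime ∂P
  /-- Given the strict past of the time of the `n`-th event, and given that this event is of type
  `k`, its size has the law `ν_k(Λ(T_n-), ·)`. -/
  size_law : ∀ (n : ℕ) (k : Fin d) (A : Set ℝ) (F : Set Ω), MeasurableSet A →
    MeasurableSet[strictPast 𝓕 (T (n + 1))] F →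
    P (F ∩ {ω | n ∈ eventIndices T X k ω} ∩ {ω | Y k (n + 1) ω ∈ A}) =
      ∫⁻ ω in F ∩ {ω | n ∈ eventIndices T X k ω},
        ν k (Function.leftLim (fun t => Λ t ω) ((T (n + 1) ω).untopD 0)) A ∂P

/-- `M` is a local martingale: it has a localizing sequence along which the stopped process is a
martingale, with almost surely càdlàg paths. -/
def IsLocalMartingale {Ω : Type*} {m : MeasurableSpace Ω} (𝓕 : Filtration ℝ≥0 m)
    (P : Measure Ω) (M : ℝ≥0 → Ω → ℝ) : Prop :=
  Locally (fun Z => Martingale Z 𝓕 P ∧ ∀ᵐ ω ∂P, IsCadlagPath fun t => Z t ω) 𝓕 M P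

section Generator

variable {Ω : Type*} [m : MeasurableSpace Ω] {d : ℕ}

/-- For every initial state `x ∈ S`, the process
`C_f(t) = f(Λ(t)) - f(Λ(0)) - ∫₀ᵗ ψ(s, Λ(s)) ds` is (well defined and) a local martingale under
`P x` for the filtration generated by `Λ`. Here `ψ` may depend on time. -/
def HasTimeDependentGenerator (S : Set (EuclideanSpace ℝ (Fin d)))
    (P : EuclideanSpace ℝ (Fin d) → Measure Ω) (Λ : ℝ≥0 → Ω → EuclideanSpace ℝ (Fin d))
    (hΛ : ∀ t, StronglyMeasurable (Λ t)) (f : EuclideanSpace ℝ (Fin d) → ℝ)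
    (ψ : ℝ≥0 → EuclideanSpace ℝ (Fin d) → ℝ) : Prop :=
  Measurable f ∧ Measurable (Function.uncurry ψ) ∧ ∀ x ∈ S,
    (∀ᵐ ω ∂(P x), ∀ t, IntegrableOn (fun s => ψ s (Λ s ω)) (Iic t) lebesgueTime) ∧
    IsLocalMartingale (Filtration.natural Λ hΛ) (P x)
      (fun t ω => f (Λ t ω) - f (Λ 0 ω) - ∫ s in Iic t, ψ s (Λ s ω) ∂lebesgueTime)

/-- `f` belongs to the domain of the extended generator `𝒜` of `Λ`, and `𝒜 f = ψ`. -/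
def HasExtendedGenerator (S : Set (EuclideanSpace ℝ (Fin d)))
    (P : EuclideanSpace ℝ (Fin d) → Measure Ω) (Λ : ℝ≥0 → Ω → EuclideanSpace ℝ (Fin d))
    (hΛ : ∀ t, StronglyMeasurable (Λ t)) (f : EuclideanSpace ℝ (Fin d) → ℝ)
    (ψ : EuclideanSpace ℝ (Fin d) → ℝ) : Prop :=
  HasTimeDependentGenerator S P Λ hΛ f (fun _ => ψ)

/-- The domain `𝒟(𝒜)` of the extended generator of `Λ`. -/
def extendedDomain (S : Set (EuclideanSpace ℝ (Fin d)))
    (P : EuclideanSpace ℝ (Fin d) → Measure Ω) (Λ : ℝ≥0 → Ω → EuclideanSpace ℝ (Fin d))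
    (hΛ : ∀ t, StronglyMeasurable (Λ t)) : Set (EuclideanSpace ℝ (Fin d) → ℝ) :=
  {f | ∃ ψ, HasExtendedGenerator S P Λ hΛ f ψ}

/-- `𝒥_k f(y) = ∫ (f(y + b_k z) - f(y)) ν_k(y, dz)`. -/
noncomputable def jumpOperator (B : Matrix (Fin d) (Fin d) ℝ)
    (ν : Fin d → Kernel (EuclideanSpace ℝ (Fin d)) ℝ) (f : EuclideanSpace ℝ (Fin d) → ℝ)
    (k : Fin d) (y : EuclideanSpace ℝ (Fin d)) : ℝ :=
  ∫ z, (f (y + z • column B k) - f y) ∂(ν k y)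

/-- `⟨μ(t, y), ∇f(y)⟩ + ∑ k, y_k 𝒥_k f(y)`, the gradient being one-sided on the boundary of the
orthant. -/
noncomputable def generator (μ : ℝ≥0 → EuclideanSpace ℝ (Fin d) → EuclideanSpace ℝ (Fin d))
    (B : Matrix (Fin d) (Fin d) ℝ) (ν : Fin d → Kernel (EuclideanSpace ℝ (Fin d)) ℝ)
    (f : EuclideanSpace ℝ (Fin d) → ℝ) (t : ℝ≥0) (y : EuclideanSpace ℝ (Fin d)) : ℝ :=
  inner ℝ (μ t y) (gradientWithin f (orthant d) y) + ∑ k, y k * jumpOperator B ν f k y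

/-- `E ∫₀ᵗ ∑ k, Λ_k(s) ∫ |f(Λ(s-) + b_k z) - f(Λ(s-))| ν_k(Λ(s-), dz) ds`, in `[0, ∞]`. -/
noncomputable def expectedJumpTerm (B : Matrix (Fin d) (Fin d) ℝ)
    (ν : Fin d → Kernel (EuclideanSpace ℝ (Fin d)) ℝ)
    (Λ : ℝ≥0 → Ω → EuclideanSpace ℝ (Fin d)) (f : EuclideanSpace ℝ (Fin d) → ℝ)
    (P : Measure Ω) (t : ℝ≥0) : ℝ≥0∞ :=
  ∫⁻ ω, ∫⁻ s in Iic t, ∑ k, ENNReal.ofReal (Λ s ω k) *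
    ∫⁻ z, ‖f (Function.leftLim (fun r => Λ r ω) s + z • column B k)
        - f (Function.leftLim (fun r => Λ r ω) s)‖ₑ
      ∂(ν k (Function.leftLim (fun r => Λ r ω) s)) ∂lebesgueTime ∂P

end Generator

end SelfExciting

namespace SelfExciting

/-! Along almost every path the events do not accumulate, so between consecutive events `Λ` is
absolutely continuous with derivative `μ(s, Λ(s))`, and at an event of type `k` and size `Y` it
moves from its left limit by `Y • b_k`. The chain rule on each piece
(`integral_fderivWithin_along_curve`), glued over the events (`IsJumpPath.change_of_variables`),
writes `f(Λ(t)) - f(Λ(0)) - ∫ ⟨μ, ∇f⟩ ds` as the sum of the increments `f(Λ(T_n-) + Y b_k) -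
f(Λ(T_n-))`.

This sum is compensated in two moves (`lintegral_tsum_event`). The conditional law of the size given
the strict past replaces each increment by its `ν_k`-average, a function of `Λ(T_n-)` alone. That
average is a predictable process evaluated at the event times, so the intensity identity turns the
sum over events into a time integral against `Λ_k(s) ds`. Both moves are made for nonnegative
functions, where no integrability is needed; the moment hypothesis then allows positive and negative
parts to be subtracted (`compensation`).

Since `Λ(s-) = Λ(s)` for almost every `s`, the compensator and the drift term add up to `∫ generator
ds`. Hence every increment of `C_f` over `(s, t]` has integral zero over each event of `𝓕 s`, a
fortiori over each event of the smaller natural filtration. So `C_f` is a true martingale, and no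
localization is needed. -/

/-! ### Lebesgue measure on the half-line and its translation to interval integrals. -/

lemma measurableEmbedding_coe_nnreal : MeasurableEmbedding ((↑) : ℝ≥0 → ℝ) :=
  MeasurableEmbedding.subtype_coe measurableSet_Ici

lemma map_restrict_lebesgueTime_Ioc (s t : ℝ≥0) :
    (lebesgueTime.restrict (Ioc s t)).map ((↑) : ℝ≥0 → ℝ) =
      (volume : Measure ℝ).restrict (Ioc (s : ℝ) t) := by
  have h1 : Ioc s t = ((↑) : ℝ≥0 → ℝ) ⁻¹' (Ioc (s : ℝ) t) := by
    ext r; simp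
  rw [h1, ← measurableEmbedding_coe_nnreal.restrict_map, lebesgueTime,
    measurableEmbedding_coe_nnreal.map_comap, Measure.restrict_restrict measurableSet_Ioc]
  congr 1
  ext r
  simp only [mem_inter_iff, mem_Ioc, mem_range, and_iff_left_iff_imp]
  rintro ⟨h, -⟩
  exact ⟨⟨r, s.2.trans h.le⟩, rfl⟩

instance : NullSingletonClass lebesgueTime := by
  constructor
  intro x
  rw [lebesgueTime, measurableEmbedding_coe_nnreal.comap_apply]
  simp

lemma lebesgueTime_Iic_lt_top (t : ℝ≥0) : lebesgueTime (Iic t) < ⊤ := by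
  rw [lebesgueTime, measurableEmbedding_coe_nnreal.comap_apply]
  refine (measure_mono ?_).trans_lt (measure_Icc_lt_top (a := (0 : ℝ)) (b := t))
  rintro _ ⟨r, hr, rfl⟩
  exact ⟨r.2, NNReal.coe_le_coe.2 hr⟩

instance : IsLocallyFiniteMeasure lebesgueTime :=
  ⟨fun x => ⟨Iic (x + 1), Iic_mem_nhds (by simp), lebesgueTime_Iic_lt_top _⟩⟩

variable {E : Type*} [NormedAddCommGroup E]

lemma integrableOn_Ioc_lebesgueTime {h : ℝ≥0 → E} {s t : ℝ≥0} (hst : s ≤ t) :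
    IntegrableOn h (Ioc s t) lebesgueTime ↔
      IntervalIntegrable (fun r : ℝ => h r.toNNReal) volume s t := by
  rw [intervalIntegrable_iff_integrableOn_Ioc_of_le (NNReal.coe_le_coe.2 hst), IntegrableOn,
    IntegrableOn, ← map_restrict_lebesgueTime_Ioc,
    measurableEmbedding_coe_nnreal.integrable_map_iff]
  simp [Function.comp_def]

variable [NormedSpace ℝ E]

lemma setIntegral_Ioc_lebesgueTime (h : ℝ≥0 → E) {s t : ℝ≥0} (hst : s ≤ t) :
    ∫ r in Ioc s t, h r ∂lebesgueTime = ∫ r in (s : ℝ)..t, h r.toNNReal := by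
  rw [intervalIntegral.integral_of_le (NNReal.coe_le_coe.2 hst), ← map_restrict_lebesgueTime_Ioc,
    measurableEmbedding_coe_nnreal.integral_map]
  simp

lemma setIntegral_Iic_lebesgueTime (h : ℝ≥0 → E) (t : ℝ≥0) :
    ∫ r in Iic t, h r ∂lebesgueTime = ∫ r in Ioc 0 t, h r ∂lebesgueTime := by
  refine setIntegral_congr_set ?_
  have : (Iic t : Set ℝ≥0) = Icc 0 t := by ext; simp
  rw [this]
  exact Ioc_ae_eq_Icc.symm

lemma setIntegral_Iic_sub_lebesgueTime {h : ℝ≥0 → E} {s t : ℝ≥0} (hst : s ≤ t)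
    (hi : IntegrableOn h (Iic t) lebesgueTime) :
    ∫ r in Iic t, h r ∂lebesgueTime =
      ∫ r in Iic s, h r ∂lebesgueTime + ∫ r in Ioc s t, h r ∂lebesgueTime := by
  rw [← Iic_union_Ioc_eq_Iic hst]
  exact setIntegral_union (by
      rw [Set.disjoint_left]; intro x hx hx'; exact absurd hx'.1 (not_lt.2 hx)) measurableSet_Ioc
    (hi.mono_set (Iic_subset_Iic.2 hst)) (hi.mono_set Ioc_subset_Iic_self)

lemma continuous_setIntegral_Iic_lebesgueTime {h : ℝ≥0 → E}
    (hi : ∀ t, IntegrableOn h (Iic t) lebesgueTime) :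
    Continuous fun t => ∫ r in Iic t, h r ∂lebesgueTime := by
  rw [continuous_iff_continuousAt]
  intro t
  have h0 : (0 : ℝ) ≤ ((t + 1 : ℝ≥0) : ℝ) := NNReal.coe_nonneg _
  have h1 : ContinuousOn (fun u : ℝ => ∫ r in (0 : ℝ)..u, h r.toNNReal)
      (Icc (0 : ℝ) ((t + 1 : ℝ≥0) : ℝ)) := by
    rw [← uIcc_of_le h0]
    refine intervalIntegral.continuousOn_primitive_interval' ?_ left_mem_uIcc
    rw [← NNReal.coe_zero, ← integrableOn_Ioc_lebesgueTime zero_le]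
    exact (hi _).mono_set Ioc_subset_Iic_self
  have h2 : ContinuousOn (fun u : ℝ≥0 => ∫ r in (0 : ℝ)..u, h r.toNNReal) (Iic (t + 1)) :=
    h1.comp NNReal.continuous_coe.continuousOn fun u hu =>
      ⟨NNReal.coe_le_coe.2 zero_le, NNReal.coe_le_coe.2 hu⟩
  refine ((h2.continuousAt (Iic_mem_nhds (by simp))).congr ?_)
  filter_upwards with u
  rw [setIntegral_Iic_lebesgueTime, setIntegral_Ioc_lebesgueTime _ zero_le]
  simp

/-! ### Chain rule along absolutely continuous curves. -/

/-- Chain rule and fundamental theorem of calculus for a `C¹` function on a closed convex set, along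
an absolutely continuous curve in that set. -/
theorem integral_fderivWithin_along_curve [FiniteDimensional ℝ E] {K : Set E}
    (hKconv : Convex ℝ K) (hKcl : IsClosed K) (hKu : UniqueDiffOn ℝ K)
    {f : E → ℝ} (hf : ContDiffOn ℝ 1 f K) {a b : ℝ} (hab : a ≤ b) {m x : ℝ → E}
    (hm : IntervalIntegrable m volume a b)
    (hx : ∀ u ∈ Icc a b, x u = x a + ∫ r in a..u, m r) (hxK : ∀ u ∈ Icc a b, x u ∈ K) :
    f (x b) - f (x a) = ∫ r in a..b, fderivWithin ℝ f K (x r) (m r) := by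
  have : CompleteSpace E := FiniteDimensional.complete ℝ E
  have hab' : uIcc a b = Icc a b := uIcc_of_le hab
  have hint : ∀ u ∈ Icc a b, ∀ v ∈ Icc a b, IntervalIntegrable m volume u v := fun u hu v hv =>
    hm.mono_set (by rw [hab']; exact uIcc_subset_Icc hu hv)
  have hxsub : ∀ u ∈ Icc a b, ∀ v ∈ Icc a b, x v - x u = ∫ r in u..v, m r := by
    intro u hu v hv
    rw [hx u hu, hx v hv, add_sub_add_left_eq_sub,
      intervalIntegral.integral_interval_sub_left (hint _ (left_mem_Icc.2 hab) _ hv)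
        (hint _ (left_mem_Icc.2 hab) _ hu)]
  have hxc : ContinuousOn x (Icc a b) := by
    have := intervalIntegral.continuousOn_primitive_interval'
      (μ := volume) (b₁ := a) (b₂ := b) (a := a) hm left_mem_uIcc
    rw [hab'] at this
    exact (continuousOn_const.add this).congr hx
  have : ProperSpace E := FiniteDimensional.proper ℝ E
  obtain ⟨R, hR⟩ := (isCompact_Icc.image_of_continuousOn hxc).isBounded.subset_closedBall 0
  -- The curve stays in a compact convex piece of `K`; there the derivative is bounded by some `M`,
  -- and convexity makes `f` `M`-Lipschitz.
  set C := Metric.closedBall (0 : E) R ∩ K with hC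
  have hCc : IsCompact C := (isCompact_closedBall 0 R).inter_right hKcl
  have hCK : C ⊆ K := inter_subset_right
  have hCconv : Convex ℝ C := (convex_closedBall 0 R).inter hKconv
  have hxC : ∀ u ∈ Icc a b, x u ∈ C := fun u hu => ⟨hR ⟨u, hu, rfl⟩, hxK u hu⟩
  have hder : ∀ y ∈ K, HasFDerivWithinAt f (fderivWithin ℝ f K y) K y := fun y hy =>
    ((hf.differentiableOn one_ne_zero) y hy).hasFDerivWithinAt
  have hdc : ContinuousOn (fderivWithin ℝ f K) K := hf.continuousOn_fderivWithin hKu le_rfl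
  obtain ⟨M, hM⟩ := hCc.exists_bound_of_continuousOn (hdc.mono hCK)
  have hlip : ∀ u ∈ C, ∀ v ∈ C, ‖f v - f u‖ ≤ M * ‖v - u‖ := fun u hu v hv =>
    hCconv.norm_image_sub_le_of_norm_hasFDerivWithin_le
      (fun y hy => (hder y (hCK hy)).mono hCK) hM hu hv
  have hM0 : 0 ≤ M := (norm_nonneg _).trans (hM _ (hxC a (left_mem_Icc.2 hab)))
  have hG := hm.norm.absolutelyContinuousOnInterval_intervalIntegral (c := a) left_mem_uIcc
  -- The increments of `f ∘ x` are dominated by `M` times those of the primitive of `‖m‖`, which is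
  -- absolutely continuous.
  have hAC : AbsolutelyContinuousOnInterval (fun u => f (x u)) a b := by
    have hG' := (hG.const_mul M)
    refine squeeze_zero' (Eventually.of_forall fun E => Finset.sum_nonneg fun _ _ => dist_nonneg) ?_
      hG'
    refine eventually_inf_principal.2 (Eventually.of_forall fun I hI => ?_)
    refine Finset.sum_le_sum fun i hi => ?_
    have h1 : (I.2 i).1 ∈ Icc a b := hab' ▸ (hI.1 i hi).1
    have h2 : (I.2 i).2 ∈ Icc a b := hab' ▸ (hI.1 i hi).2
    rw [dist_comm, dist_comm (M * _), Real.dist_eq, Real.dist_eq, ← mul_sub,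
      intervalIntegral.integral_interval_sub_left (hint _ (left_mem_Icc.2 hab) _ h2).norm
        (hint _ (left_mem_Icc.2 hab) _ h1).norm, abs_mul, abs_of_nonneg hM0]
    refine (hlip _ (hxC _ h1) _ (hxC _ h2)).trans (mul_le_mul_of_nonneg_left ?_ hM0)
    rw [hxsub _ h1 _ h2]
    exact intervalIntegral.norm_integral_le_abs_integral_norm
  rw [← hAC.integral_deriv_eq_sub]
  refine intervalIntegral.integral_congr_ae ?_
  -- Lebesgue differentiation gives `x' = m` almost everywhere; dropping the endpoint `b` leaves
  -- interior points, where the derivative within the interval is a genuine one.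
  have hne : ∀ᵐ r : ℝ, r ≠ b := by simp [ae_iff]
  filter_upwards [hm.ae_hasDerivAt_integral, hne] with r hr hrb hrab
  rw [uIoc_of_le hab] at hrab
  have hrI : r ∈ Ioo a b := ⟨hrab.1, lt_of_le_of_ne hrab.2 hrb⟩
  have hrI' := Ioo_subset_Icc_self hrI
  have hd : HasDerivWithinAt x (m r) (Icc a b) r := by
    have := ((hr (hab' ▸ hrI') a left_mem_uIcc).const_add (x a)).hasDerivWithinAt (s := Icc a b)
    exact this.congr hx (hx r hrI')
  exact (((hder _ (hxK r hrI')).comp_hasDerivWithinAt r hd hxK).hasDerivAt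
    (Icc_mem_nhds hrI.1 hrI.2)).deriv

/-! ### Change of variables for paths with isolated jumps. -/

/-- A path driven by the drift `a`, with jumps `v m` at the times `T (m + 1)`, which increase
strictly to infinity. -/
structure IsJumpPath {E : Type*} [NormedAddCommGroup E] [NormedSpace ℝ E]
    (T : ℕ → WithTop ℝ≥0) (v : ℕ → E) (a : ℝ≥0 → E) (g : ℝ≥0 → E) : Prop where
  zero : T 0 = 0
  mono : Monotone T
  strict : ∀ n, T n < ⊤ → T n < T (n + 1)
  tendsto : Tendsto T atTop (𝓝 ⊤)
  drift : ∀ t, IntegrableOn a (Iic t) lebesgueTime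
  eq : ∀ t : ℝ≥0, g t =
    g 0 + ∫ s in Iic t, a s ∂lebesgueTime + ∑' m, if T (m + 1) ≤ t then v m else 0

namespace IsJumpPath

variable {E : Type*} [NormedAddCommGroup E] [NormedSpace ℝ E]
  {T : ℕ → WithTop ℝ≥0} {v : ℕ → E} {a g : ℝ≥0 → E}

/-- The first time `T n` beyond `u` exists because the times tend to `⊤`, and its index is positive
because `T 0 = 0`. -/
lemma exists_index (h : IsJumpPath T v a g) (u : ℝ≥0) :
    ∃ n, T n ≤ u ∧ (u : WithTop ℝ≥0) < T (n + 1) := by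
  classical
  have hex : ∃ n, (u : WithTop ℝ≥0) < T n :=
    (h.tendsto.eventually (lt_mem_nhds (WithTop.coe_lt_top u))).exists
  have h0 : Nat.find hex ≠ 0 := fun h0 => by
    have := Nat.find_spec hex
    rw [h0, h.zero] at this
    exact not_lt_zero this
  obtain ⟨n, hn⟩ := Nat.exists_eq_succ_of_ne_zero h0
  exact ⟨n, not_lt.1 (Nat.find_min hex (by omega)), by
    have := Nat.find_spec hex
    rwa [hn] at this⟩

lemma le_iff_lt_index (h : IsJumpPath T v a g) {n : ℕ} {u : ℝ≥0} (h1 : T n ≤ u)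
    (h2 : (u : WithTop ℝ≥0) < T (n + 1)) (m : ℕ) : T (m + 1) ≤ u ↔ m < n := by
  constructor
  · intro hm
    by_contra hmn
    exact absurd (h2.trans_le (h.mono (by omega : n + 1 ≤ m + 1))) (not_lt.2 hm)
  · intro hm
    exact (h.mono (by omega)).trans h1

lemma tsum_ite_eq_sum_range (h : IsJumpPath T v a g) {n : ℕ} {u : ℝ≥0} (h1 : T n ≤ u)
    (h2 : (u : WithTop ℝ≥0) < T (n + 1)) {F : Type*} [AddCommMonoid F] [TopologicalSpace F]
    (c : ℕ → F) :
    (∑' m, if T (m + 1) ≤ u then c m else 0) = ∑ m ∈ Finset.range n, c m := by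
  rw [tsum_eq_sum (s := Finset.range n)]
  · exact Finset.sum_congr rfl fun m hm =>
      if_pos ((h.le_iff_lt_index h1 h2 m).2 (Finset.mem_range.1 hm))
  · intro m hm
    exact if_neg fun hm' => hm (Finset.mem_range.2 ((h.le_iff_lt_index h1 h2 m).1 hm'))

lemma eq_of_mem (h : IsJumpPath T v a g) {n : ℕ} {u : ℝ≥0} (h1 : T n ≤ u)
    (h2 : (u : WithTop ℝ≥0) < T (n + 1)) :
    g u = g 0 + ∫ s in Iic u, a s ∂lebesgueTime + ∑ m ∈ Finset.range n, v m := by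
  rw [h.eq u, h.tsum_ite_eq_sum_range h1 h2]

/-- The formula of `eq_of_mem` is continuous in `u`, so it gives the left limit even at `u = T (n +
1)`, where the path itself has already jumped. -/
lemma leftLim_of_mem (h : IsJumpPath T v a g) {n : ℕ} {u : ℝ≥0} (h1 : T n < u)
    (h2 : (u : WithTop ℝ≥0) ≤ T (n + 1)) :
    Function.leftLim g u =
      g 0 + ∫ s in Iic u, a s ∂lebesgueTime + ∑ m ∈ Finset.range n, v m := by
  obtain ⟨τ, hτ⟩ : ∃ τ : ℝ≥0, T n = τ :=
    ⟨_, (WithTop.coe_untop _ (h1.trans_le le_top).ne).symm⟩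
  have hτu : τ < u := by rw [hτ] at h1; exact WithTop.coe_lt_coe.1 h1
  have : (𝓝[<] u).NeBot := nhdsLT_neBot_of_exists_lt ⟨τ, hτu⟩
  apply leftLim_eq_of_tendsto
  have hc : Tendsto (fun u => g 0 + ∫ s in Iic u, a s ∂lebesgueTime + ∑ m ∈ Finset.range n, v m)
      (𝓝[<] u) (𝓝 (g 0 + ∫ s in Iic u, a s ∂lebesgueTime + ∑ m ∈ Finset.range n, v m)) :=
    (((continuous_setIntegral_Iic_lebesgueTime h.drift).tendsto u).mono_left
      nhdsWithin_le_nhds).const_add _ |>.add_const _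
  refine hc.congr' ?_
  filter_upwards [Ioo_mem_nhdsLT hτu] with r hr
  exact (h.eq_of_mem (hτ ▸ WithTop.coe_le_coe.2 hr.1.le)
    ((WithTop.coe_lt_coe.2 hr.2).trans_le h2)).symm

lemma leftLim_eq_self (h : IsJumpPath T v a g) {u : ℝ≥0} (hu : ∀ m, T m ≠ u) :
    Function.leftLim g u = g u := by
  obtain ⟨n, h1, h2⟩ := h.exists_index u
  rw [h.leftLim_of_mem (lt_of_le_of_ne h1 (hu n)) h2.le, h.eq_of_mem h1 h2]

/-- The path can only jump at countably many times, a Lebesgue null set. This is what lets the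
compensator be written with `Λ(s)` in place of `Λ(s-)`. -/
lemma ae_leftLim_eq (h : IsJumpPath T v a g) :
    ∀ᵐ u ∂lebesgueTime, Function.leftLim g u = g u := by
  have : (range fun n => (T n).untopD 0).Countable := countable_range _
  filter_upwards [this.ae_notMem lebesgueTime] with u hu
  exact h.leftLim_eq_self fun m hm => hu ⟨m, (congrArg _ hm).trans (WithTop.untopD_coe _ _)⟩

lemma eq_leftLim_add (h : IsJumpPath T v a g) {m : ℕ} {u : ℝ≥0} (hu : T (m + 1) = u) :
    g u = Function.leftLim g u + v m := by
  have hlt : ∀ n, T n ≤ u → T n < T (n + 1) := fun n hn =>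
    h.strict n (hn.trans_lt (WithTop.coe_lt_top u))
  have h1 : T m < u := hu ▸ hlt m (hu ▸ h.mono (Nat.le_succ m))
  rw [h.leftLim_of_mem h1 hu.ge, h.eq_of_mem hu.le (hu ▸ hlt (m + 1) hu.le),
    Finset.sum_range_succ, ← add_assoc]

variable {K : Set E} {f : E → ℝ}

/-- The derivative term in the change of variables formula is integrable. -/
lemma integrableOn_fderivWithin (h : IsJumpPath T v a g) (hcad : IsCadlagPath g)
    (hKcl : IsClosed K) (hKu : UniqueDiffOn ℝ K) (hf : ContDiffOn ℝ 1 f K) (hg : ∀ t, g t ∈ K)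
    (hmeas : AEStronglyMeasurable (fun r => fderivWithin ℝ f K (g r) (a r)) lebesgueTime)
    (t : ℝ≥0) : IntegrableOn (fun r => fderivWithin ℝ f K (g r) (a r)) (Iic t) lebesgueTime := by
  -- The path may jump, so its image need not be compact. The bound is obtained near each time from
  -- the right and left limits, the latter lying in `K` by closedness, and compactness of `[0, t]`
  -- patches these bounds together.
  obtain ⟨M, hM⟩ : ∃ M, ∀ r ∈ Icc 0 t, ‖fderivWithin ℝ f K (g r)‖ ≤ M := by
    have hdc : ContinuousOn (fderivWithin ℝ f K) K := hf.continuousOn_fderivWithin hKu le_rfl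
    refine isCompact_Icc.induction_on (p := fun s => ∃ M, ∀ r ∈ s, ‖fderivWithin ℝ f K (g r)‖ ≤ M)
      ⟨0, by simp⟩ (fun s s' hss' ⟨M, hM⟩ => ⟨M, fun r hr => hM r (hss' hr)⟩)
      (fun s s' ⟨M, hM⟩ ⟨M', hM'⟩ => ⟨max M M', fun r hr => hr.elim
        (fun hr => (hM r hr).trans (le_max_left _ _))
        (fun hr => (hM' r hr).trans (le_max_right _ _))⟩) ?_
    intro u _
    have aux : ∀ (F : Filter ℝ≥0) (y : E), y ∈ K → Tendsto g F (𝓝 y) →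
        ∀ᶠ r in F, ‖fderivWithin ℝ f K (g r)‖ ≤ ‖fderivWithin ℝ f K y‖ + 1 := by
      intro F y hy hF
      have h1 : Tendsto g F (𝓝[K] y) :=
        tendsto_nhdsWithin_iff.2 ⟨hF, Eventually.of_forall hg⟩
      have h2 := ((hdc y hy).norm.tendsto.comp h1).eventually
        (Iic_mem_nhds (lt_add_one ‖fderivWithin ℝ f K y‖))
      exact h2
    obtain ⟨hr, l, hl⟩ := hcad u
    have e1 := aux (𝓝[≥] u) (g u) (hg u) hr
    have e2 : ∃ M, ∀ᶠ r in 𝓝[<] u, ‖fderivWithin ℝ f K (g r)‖ ≤ M := by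
      rcases eq_or_neBot (𝓝[<] u) with hb | hb
      · exact ⟨0, by simp [hb]⟩
      · exact ⟨_, aux _ l (hKcl.mem_of_tendsto hl (Eventually.of_forall hg)) hl⟩
    obtain ⟨M, e2⟩ := e2
    refine ⟨{r | ‖fderivWithin ℝ f K (g r)‖ ≤ max M (‖fderivWithin ℝ f K (g u)‖ + 1)},
      mem_nhdsWithin_of_mem_nhds ?_, _, fun r hr => hr⟩
    rw [← nhdsLT_sup_nhdsGE]
    exact ⟨e2.mono fun r hr => hr.trans (le_max_left _ _),
      e1.mono fun r hr => hr.trans (le_max_right _ _)⟩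
  refine Integrable.mono' ((h.drift t).norm.const_mul M) hmeas.restrict ?_
  refine (ae_restrict_iff' measurableSet_Iic).2 (Eventually.of_forall fun r hr => ?_)
  exact (ContinuousLinearMap.le_opNorm _ _).trans
    (mul_le_mul_of_nonneg_right (hM r ⟨zero_le, hr⟩) (norm_nonneg _))

variable [FiniteDimensional ℝ E]

/-- Change of variables between two consecutive jump times. -/
lemma integral_fderivWithin_between (h : IsJumpPath T v a g) (hKconv : Convex ℝ K)
    (hKcl : IsClosed K) (hKu : UniqueDiffOn ℝ K) (hf : ContDiffOn ℝ 1 f K) (hg : ∀ t, g t ∈ K)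
    {n : ℕ} {τ u : ℝ≥0} (hτ : T n = τ) (hτu : τ ≤ u) (hu : (u : WithTop ℝ≥0) ≤ T (n + 1)) :
    f (g 0 + ∫ s in Iic u, a s ∂lebesgueTime + ∑ m ∈ Finset.range n, v m) - f (g τ) =
      ∫ r in Ioc τ u, fderivWithin ℝ f K (g r) (a r) ∂lebesgueTime := by
  -- `x` continues the path without the jump at `T (n + 1)`: it equals `g` before that time and its
  -- left limit at that time.
  set x : ℝ≥0 → E := fun u => g 0 + ∫ s in Iic u, a s ∂lebesgueTime + ∑ m ∈ Finset.range n, v m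
    with hx
  have hτn : (τ : WithTop ℝ≥0) < T (n + 1) := by
    rw [← hτ]; exact h.strict n (hτ ▸ WithTop.coe_lt_top _)
  have hxg : ∀ r, τ ≤ r → (r : WithTop ℝ≥0) < T (n + 1) → g r = x r := fun r hr hr' =>
    h.eq_of_mem (hτ ▸ WithTop.coe_le_coe.2 hr) hr'
  have hxc : Continuous x :=
    ((continuous_setIntegral_Iic_lebesgueTime h.drift).const_add _).add_const _
  have hxK : ∀ r, τ ≤ r → r ≤ u → x r ∈ K := by
    intro r hr hru
    rcases ((WithTop.coe_le_coe.2 hru).trans hu).lt_or_eq with hlt | heq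
    · rw [← hxg r hr hlt]; exact hg r
    · have hτr : τ < r := by rw [← heq] at hτn; exact WithTop.coe_lt_coe.1 hτn
      have : (𝓝[<] r).NeBot := nhdsLT_neBot_of_exists_lt ⟨τ, hτr⟩
      refine hKcl.mem_of_tendsto (hxc.continuousWithinAt (s := Iio r)) ?_
      filter_upwards [Ioo_mem_nhdsLT hτr] with q hq
      rw [← hxg q hq.1.le (heq ▸ WithTop.coe_lt_coe.2 hq.2)]
      exact hg q
  have hab : (τ : ℝ) ≤ u := NNReal.coe_le_coe.2 hτu
  have hI : ∀ r : ℝ≥0, τ ≤ r → IntervalIntegrable (fun r : ℝ => a r.toNNReal) volume τ r :=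
    fun r hr => (integrableOn_Ioc_lebesgueTime hr).1 ((h.drift r).mono_set Ioc_subset_Iic_self)
  have hmem : ∀ r ∈ Icc (τ : ℝ) u, τ ≤ r.toNNReal ∧ r.toNNReal ≤ u ∧ (r.toNNReal : ℝ) = r :=
    fun r hr => ⟨NNReal.le_toNNReal_of_coe_le hr.1, Real.toNNReal_le_iff_le_coe.2 hr.2,
      Real.coe_toNNReal r (τ.2.trans hr.1)⟩
  have key := integral_fderivWithin_along_curve hKconv hKcl hKu hf hab (hI u hτu)
    (x := fun r => x r.toNNReal)
    (fun r hr => by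
      obtain ⟨h1, h2, h3⟩ := hmem r hr
      conv_rhs => rw [← h3]
      rw [← setIntegral_Ioc_lebesgueTime _ h1]
      simp only [hx, Real.toNNReal_coe]
      rw [setIntegral_Iic_sub_lebesgueTime h1 (h.drift _)]
      abel)
    (fun r hr => hxK _ (hmem r hr).1 (hmem r hr).2.1)
  rw [setIntegral_Ioc_lebesgueTime _ hτu]
  simp only [Real.toNNReal_coe] at key
  rw [hxg τ le_rfl hτn, key]
  refine intervalIntegral.integral_congr_ae ?_
  -- At `u = T (n + 1)` the curves `x` and `g` may differ, so this single point is discarded.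
  have hne : ∀ᵐ r : ℝ, r ≠ u := by simp [ae_iff]
  filter_upwards [hne] with r hru hr
  rw [uIoc_of_le hab] at hr
  have h1 := hmem r (Ioc_subset_Icc_self hr)
  have hlt : r.toNNReal < u := by
    rw [← NNReal.coe_lt_coe, h1.2.2]; exact lt_of_le_of_ne hr.2 hru
  rw [hxg _ h1.1 ((WithTop.coe_lt_coe.2 hlt).trans_le hu)]

/-- Change of variables formula for a path with finitely many jumps in bounded intervals. -/
theorem change_of_variables (h : IsJumpPath T v a g) (hKconv : Convex ℝ K)
    (hKcl : IsClosed K) (hKu : UniqueDiffOn ℝ K) (hf : ContDiffOn ℝ 1 f K) (hg : ∀ t, g t ∈ K)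
    (hint : ∀ t, IntegrableOn (fun r => fderivWithin ℝ f K (g r) (a r)) (Iic t) lebesgueTime)
    (t : ℝ≥0) :
    f (g t) - f (g 0) = ∫ r in Iic t, fderivWithin ℝ f K (g r) (a r) ∂lebesgueTime +
      ∑' m, if T (m + 1) ≤ t then
        f (Function.leftLim g ((T (m + 1)).untopD 0) + v m)
          - f (Function.leftLim g ((T (m + 1)).untopD 0)) else 0 := by
  -- Induction on the number of events gives the formula at event times; the stretch after the last
  -- event before `t` is added at the end.
  have hA : ∀ (n : ℕ) (τ : ℝ≥0), T n = τ → f (g τ) - f (g 0) =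
      ∫ r in Iic τ, fderivWithin ℝ f K (g r) (a r) ∂lebesgueTime +
      ∑ m ∈ Finset.range n, (f (Function.leftLim g ((T (m + 1)).untopD 0) + v m)
          - f (Function.leftLim g ((T (m + 1)).untopD 0))) := by
    intro n
    induction n with
    | zero =>
      intro τ hτ
      obtain rfl : τ = 0 := by
        rw [h.zero] at hτ; exact (WithTop.coe_eq_zero.1 hτ.symm)
      rw [setIntegral_Iic_lebesgueTime]
      simp
    | succ n ih =>
      intro τ hτ
      have hlt : T n < T (n + 1) :=
        h.strict n ((h.mono (Nat.le_succ n)).trans_lt (hτ ▸ WithTop.coe_lt_top τ))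
      obtain ⟨σ, hσ⟩ : ∃ σ : ℝ≥0, T n = σ :=
        ⟨_, (WithTop.coe_untop _ (hlt.trans_le le_top).ne).symm⟩
      have hστ : σ < τ := by rw [hσ, hτ] at hlt; exact WithTop.coe_lt_coe.1 hlt
      have h1 := h.integral_fderivWithin_between hKconv hKcl hKu hf hg hσ hστ.le hτ.ge
      rw [← h.leftLim_of_mem (hτ ▸ hlt) hτ.ge] at h1
      rw [Finset.sum_range_succ, setIntegral_Iic_sub_lebesgueTime hστ.le (hint τ), ← h1,
        hτ, WithTop.untopD_coe, ← h.eq_leftLim_add hτ]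
      linarith [ih σ hσ]
  obtain ⟨n, h1, h2⟩ := h.exists_index t
  obtain ⟨σ, hσ⟩ : ∃ σ : ℝ≥0, T n = σ :=
    ⟨_, (WithTop.coe_untop _ (h1.trans_lt (WithTop.coe_lt_top t)).ne).symm⟩
  have hσt : σ ≤ t := by rw [hσ] at h1; exact WithTop.coe_le_coe.1 h1
  have h3 := h.integral_fderivWithin_between hKconv hKcl hKu hf hg hσ hσt h2.le
  rw [← h.eq_of_mem h1 h2] at h3
  rw [h.tsum_ite_eq_sum_range h1 h2, setIntegral_Iic_sub_lebesgueTime hσt (hint t), ← h3]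
  linarith [hA n σ hσ]

end IsJumpPath

/-! ### Approximation of càdlàg paths on grids. -/

section Paths

variable {E : Type*} [TopologicalSpace E]

/-- Grid points that approach `s` from strictly below when `0 < s`. -/
noncomputable def gridBelow (n : ℕ) (s : ℝ≥0) : ℝ≥0 := ((⌈s * (n + 1)⌉₊ - 1 : ℕ) : ℝ≥0) / (n + 1)

/-- Grid points that approach `s` from strictly above. -/
noncomputable def gridAbove (n : ℕ) (s : ℝ≥0) : ℝ≥0 := ((⌊s * (n + 1)⌋₊ + 1 : ℕ) : ℝ≥0) / (n + 1)

lemma gridBelow_zero (n : ℕ) : gridBelow n 0 = 0 := by simp [gridBelow]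

lemma gridBelow_lt {s : ℝ≥0} (hs : 0 < s) (n : ℕ) : gridBelow n s < s := by
  have hn : (0 : ℝ≥0) < n + 1 := by positivity
  rw [gridBelow, div_lt_iff₀ hn]
  have hpos : 0 < ⌈s * (n + 1)⌉₊ := Nat.ceil_pos.2 (mul_pos hs hn)
  exact Nat.lt_ceil.1 (by omega)

lemma le_gridBelow_add (s : ℝ≥0) (n : ℕ) : s ≤ gridBelow n s + 1 / (n + 1) := by
  have hn : (0 : ℝ≥0) < n + 1 := by positivity
  rw [gridBelow, ← add_div, le_div_iff₀ hn]
  refine (Nat.le_ceil _).trans ?_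
  have : ⌈s * (n + 1)⌉₊ ≤ (⌈s * (n + 1)⌉₊ - 1) + 1 := by omega
  exact_mod_cast this

lemma lt_gridAbove (s : ℝ≥0) (n : ℕ) : s < gridAbove n s := by
  have hn : (0 : ℝ≥0) < n + 1 := by positivity
  rw [gridAbove, lt_div_iff₀ hn]
  exact_mod_cast Nat.lt_floor_add_one (s * (n + 1))

lemma gridAbove_le (s : ℝ≥0) (n : ℕ) : gridAbove n s ≤ s + 1 / (n + 1) := by
  have hn : (0 : ℝ≥0) < n + 1 := by positivity
  rw [gridAbove, div_le_iff₀ hn, add_mul, one_div, inv_mul_cancel₀ hn.ne']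
  push_cast
  gcongr
  exact Nat.floor_le zero_le

lemma tendsto_one_div_add_one_nnreal :
    Tendsto (fun n : ℕ => 1 / ((n : ℝ≥0) + 1)) atTop (𝓝 0) := by
  rw [← NNReal.tendsto_coe]
  simpa using tendsto_one_div_add_atTop_nhds_zero_nat (𝕜 := ℝ)

lemma tendsto_gridBelow {s : ℝ≥0} (hs : 0 < s) :
    Tendsto (fun n => gridBelow n s) atTop (𝓝[<] s) := by
  refine tendsto_nhdsWithin_iff.2 ⟨?_, Eventually.of_forall fun n => gridBelow_lt hs n⟩
  have h1 : Tendsto (fun n : ℕ => s - 1 / ((n : ℝ≥0) + 1)) atTop (𝓝 s) := by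
    simpa using tendsto_one_div_add_one_nnreal.const_sub s
  exact tendsto_of_tendsto_of_tendsto_of_le_of_le h1 tendsto_const_nhds
    (fun n => tsub_le_iff_right.2 (le_gridBelow_add s n)) fun n => (gridBelow_lt hs n).le

lemma tendsto_gridAbove (s : ℝ≥0) : Tendsto (fun n => gridAbove n s) atTop (𝓝[≥] s) := by
  refine tendsto_nhdsWithin_iff.2 ⟨?_, Eventually.of_forall fun n => (lt_gridAbove s n).le⟩
  have h1 : Tendsto (fun n : ℕ => s + 1 / ((n : ℝ≥0) + 1)) atTop (𝓝 s) := by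
    simpa using tendsto_one_div_add_one_nnreal.const_add s
  exact tendsto_of_tendsto_of_tendsto_of_le_of_le tendsto_const_nhds h1
    (fun n => (lt_gridAbove s n).le) fun n => gridAbove_le s n

lemma tendsto_comp_gridBelow [T2Space E] {g : ℝ≥0 → E} (hg : IsCadlagPath g) (s : ℝ≥0) :
    Tendsto (fun n => g (gridBelow n s)) atTop (𝓝 (Function.leftLim g s)) := by
  -- At `0` there is nothing to the left: `Function.leftLim` is the value itself, and the grid point
  -- is `0` as well.
  rcases eq_or_ne s 0 with rfl | hs
  · rw [leftLim_eq_of_isBot (fun _ => zero_le)]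
    simp [gridBelow_zero]
  · exact (tendsto_leftLim_of_tendsto (hg s).2).comp (tendsto_gridBelow (pos_iff_ne_zero.2 hs))

lemma tendsto_comp_min_gridAbove {g : ℝ≥0 → E} (hg : IsCadlagPath g) (s t : ℝ≥0) :
    Tendsto (fun n => g (min (gridAbove n s) t)) atTop (𝓝 (g (min s t))) := by
  rcases lt_or_ge s t with hst | hst
  · rw [min_eq_left hst.le]
    have h1 : Tendsto (fun n => min (gridAbove n s) t) atTop (𝓝[≥] s) := by
      refine (tendsto_gridAbove s).congr' ?_
      have := (tendsto_nhdsWithin_iff.1 (tendsto_gridAbove s)).1.eventually (Iio_mem_nhds hst)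
      filter_upwards [this] with n hn
      exact (min_eq_left (le_of_lt hn)).symm
    exact (hg s).1.tendsto.comp h1
  · rw [min_eq_right hst]
    refine tendsto_const_nhds.congr fun n => ?_
    rw [min_eq_right (hst.trans (lt_gridAbove s n).le)]

end Paths

/-! ### Joint measurability and predictability of càdlàg processes. -/

section Measurability

lemma measurable_comp_discrete {Ω E : Type*} [MeasurableSpace Ω] [MeasurableSpace E]
    {Λ : ℝ≥0 → Ω → E} {c : ℕ → ℝ≥0} {q : ℝ≥0 → ℕ} (hΛ : ∀ j, Measurable (Λ (c j)))
    (hq : Measurable q) : Measurable fun p : ℝ≥0 × Ω => Λ (c (q p.1)) p.2 := by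
  have h1 : Measurable fun x : ℕ × Ω => Λ (c x.1) x.2 := measurable_from_prod_countable_right hΛ
  exact h1.comp ((hq.comp measurable_fst).prodMk measurable_snd)

variable {Ω : Type*} {m : MeasurableSpace Ω} {E : Type*} [TopologicalSpace E]
  [TopologicalSpace.PseudoMetrizableSpace E] [MeasurableSpace E] [BorelSpace E]
  {Λ : ℝ≥0 → Ω → E}

/-- A càdlàg process, stopped at the deterministic time `t`, is jointly measurable. -/
lemma measurable_uncurry_min {t : ℝ≥0} (hΛ : ∀ s ≤ t, Measurable (Λ s))
    (hcad : ∀ ω, IsCadlagPath fun t => Λ t ω) :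
    Measurable fun p : ℝ≥0 × Ω => Λ (min p.1 t) p.2 := by
  refine measurable_of_tendsto_metrizable (f := fun n (p : ℝ≥0 × Ω) =>
    Λ (min (gridAbove n p.1) t) p.2) (fun n => ?_)
    (tendsto_pi_nhds.2 fun p => tendsto_comp_min_gridAbove (hcad p.2) p.1 t)
  have hq : Measurable fun s : ℝ≥0 => ⌊s * ((n : ℝ≥0) + 1)⌋₊ :=
    Nat.measurable_floor.comp (measurable_id.mul_const _)
  have hc : ∀ j : ℕ, Measurable (Λ (min (((j + 1 : ℕ) : ℝ≥0) / (n + 1)) t)) := fun j =>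
    hΛ _ (min_le_right _ t)
  have := measurable_comp_discrete (c := fun j => min (((j + 1 : ℕ) : ℝ≥0) / (n + 1)) t) hc hq
  simpa only [gridAbove] using this

variable [T2Space E] {𝓕 : Filtration ℝ≥0 m}

/-- The process of left limits of an adapted càdlàg process is predictable. -/
lemma measurable_predictable_leftLim (hΛ : ∀ t, Measurable[𝓕 t] (Λ t))
    (hcad : ∀ ω, IsCadlagPath fun t => Λ t ω) :
    Measurable[𝓕.predictable] fun p : ℝ≥0 × Ω => Function.leftLim (fun t => Λ t p.2) p.1 := by
  refine @measurable_of_tendsto_metrizable _ _ (𝓕.predictable) _ _ _ _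
    (fun n (p : ℝ≥0 × Ω) => Λ (gridBelow n p.1) p.2) _ (fun n => ?_)
    (tendsto_pi_nhds.2 fun p => tendsto_comp_gridBelow (hcad p.2) p.1)
  intro C hC
  have hn : (0 : ℝ≥0) < n + 1 := by positivity
  -- `gridBelow n` is constant on each cell `(j/(n+1), (j+1)/(n+1)]`, equal to its left end. The
  -- preimage is thus a countable union of predictable rectangles, plus the slice at time `0`.
  have heq : (fun p : ℝ≥0 × Ω => Λ (gridBelow n p.1) p.2) ⁻¹' C =
      ({⊥} ×ˢ (Λ 0 ⁻¹' C)) ∪ ⋃ j : ℕ, Ioc ((j : ℝ≥0) / (n + 1)) ((j + 1 : ℕ) / (n + 1)) ×ˢ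
        (Λ ((j : ℝ≥0) / (n + 1)) ⁻¹' C) := by
    ext ⟨s, ω⟩
    have key : ∀ j : ℕ, s ∈ Ioc ((j : ℝ≥0) / (n + 1)) ((j + 1 : ℕ) / (n + 1)) →
        gridBelow n s = (j : ℝ≥0) / (n + 1) := by
      intro j hj
      have : ⌈s * (n + 1)⌉₊ = j + 1 :=
        (Nat.ceil_eq_iff (by omega)).2 ⟨by
          simpa using (div_lt_iff₀ hn).1 hj.1, (le_div_iff₀ hn).1 hj.2⟩
      simp [gridBelow, this]
    simp only [mem_preimage, mem_union, mem_prod, mem_singleton_iff, mem_iUnion]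
    constructor
    · intro h
      rcases eq_or_ne s 0 with rfl | hs
      · left; rw [gridBelow_zero] at h; exact ⟨rfl, h⟩
      · right
        have hs' := pos_iff_ne_zero.2 hs
        have hpos : 0 < ⌈s * (n + 1)⌉₊ := Nat.ceil_pos.2 (mul_pos hs' hn)
        refine ⟨⌈s * (n + 1)⌉₊ - 1, ⟨gridBelow_lt hs' n, ?_⟩, h⟩
        rw [le_div_iff₀ hn, Nat.sub_add_cancel hpos]
        exact Nat.le_ceil _
    · rintro (⟨hs, h⟩ | ⟨j, hj, h⟩)
      · have hs : s = 0 := hs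
        rw [hs, gridBelow_zero]; exact h
      · rw [key j hj]; exact h
  rw [heq]
  exact (measurableSet_predictable_singleton_bot_prod (hΛ 0 hC)).union
    (MeasurableSet.iUnion fun j => measurableSet_predictable_Ioc_prod _ _ (hΛ _ hC))

lemma predictable_le_prod : 𝓕.predictable ≤ (inferInstance : MeasurableSpace (ℝ≥0 × Ω)) :=
  measurableSpace_le_predictable_of_measurableSet
    (fun A hA => (measurableSet_singleton _).prod (𝓕.le _ A hA))
    fun i A hA => measurableSet_Ioi.prod (𝓕.le i A hA)

/-! ### The strict past of a random time. -/

section StrictPast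

variable {τ : Ω → WithTop ℝ≥0}

lemma strictPast_le (hτ : IsStoppingTime 𝓕 τ) : strictPast 𝓕 τ ≤ m := by
  refine MeasurableSpace.generateFrom_le ?_
  rintro _ (hA | ⟨t, A, hA, rfl⟩)
  · exact 𝓕.le 0 _ hA
  · refine (𝓕.le t _ hA).inter ?_
    have : {ω | (t : WithTop ℝ≥0) < τ ω} = {ω | τ ω ≤ t}ᶜ := by
      ext ω; exact (not_le (a := τ ω) (b := (t : WithTop ℝ≥0))).symm
    rw [this]
    exact (𝓕.le t _ (hτ t)).compl

lemma measurableSet_strictPast_inter_lt {t : ℝ≥0} {A : Set Ω} (hA : MeasurableSet[𝓕 t] A) :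
    MeasurableSet[strictPast 𝓕 τ] (A ∩ {ω | (t : WithTop ℝ≥0) < τ ω}) :=
  MeasurableSpace.measurableSet_generateFrom (Or.inr ⟨t, A, hA, rfl⟩)

lemma measurableSet_strictPast_lt (t : ℝ≥0) :
    MeasurableSet[strictPast 𝓕 τ] {ω | (t : WithTop ℝ≥0) < τ ω} := by
  simpa using measurableSet_strictPast_inter_lt (𝓕 := 𝓕) (τ := τ) (t := t) (A := univ) .univ

lemma measurableSet_strictPast_le (t : ℝ≥0) :
    MeasurableSet[strictPast 𝓕 τ] {ω | τ ω ≤ t} := by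
  have : {ω | τ ω ≤ t} = {ω | (t : WithTop ℝ≥0) < τ ω}ᶜ := by
    ext ω; exact (not_lt (a := (t : WithTop ℝ≥0)) (b := τ ω)).symm
  rw [this]
  exact (measurableSet_strictPast_lt t).compl

lemma measurableSet_strictPast_lt_top :
    MeasurableSet[strictPast 𝓕 τ] {ω | τ ω < ⊤} := by
  have : {ω | τ ω < ⊤} = ⋃ n : ℕ, {ω | τ ω ≤ ((n : ℝ≥0) : WithTop ℝ≥0)} := by
    ext ω
    simp only [mem_ofPred_eq, mem_iUnion]
    constructor
    · intro h
      obtain ⟨r, hr⟩ := WithTop.ne_top_iff_exists.1 h.ne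
      obtain ⟨n, hn⟩ := exists_nat_ge r
      exact ⟨n, hr ▸ WithTop.coe_le_coe.2 hn⟩
    · rintro ⟨n, hn⟩
      exact hn.trans_lt (WithTop.coe_lt_top _)
  rw [this]
  exact MeasurableSet.iUnion fun n => measurableSet_strictPast_le _

/-- A predictable process, evaluated at a random time, is measurable with respect to the strict
past of this time. -/
lemma measurable_strictPast_predictable :
    @Measurable _ _ (strictPast 𝓕 τ) 𝓕.predictable fun ω => ((τ ω).untopD 0, ω) := by
  refine @measurable_generateFrom _ _ (strictPast 𝓕 τ) _ _ ?_
  have h0 : ∀ A, MeasurableSet[𝓕 0] A → MeasurableSet[strictPast 𝓕 τ] A := fun A hA =>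
    MeasurableSpace.measurableSet_generateFrom (Or.inl hA)
  -- `untopD` sends `⊤` to `0`, so finiteness of `τ` has to be imposed separately.
  have hlt : ∀ t : ℝ≥0, {ω | t < (τ ω).untopD 0} = {ω | (t : WithTop ℝ≥0) < τ ω} ∩ {ω | τ ω < ⊤} := by
    intro t
    ext ω
    simp only [mem_ofPred_eq, mem_inter_iff]
    induction τ ω with
    | top => simp
    | coe r =>
      rw [WithTop.untopD_coe]
      exact ⟨fun h => ⟨WithTop.coe_lt_coe.2 h, WithTop.coe_lt_top r⟩, fun h => WithTop.coe_lt_coe.1 h.1⟩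
  rintro _ (⟨A, hA, rfl⟩ | ⟨t, A, hA, rfl⟩)
  · have : (fun ω => ((τ ω).untopD 0, ω)) ⁻¹' ({⊥} ×ˢ A) = {ω | 0 < (τ ω).untopD 0}ᶜ ∩ A := by
      ext ω; simp
    rw [this, hlt]
    exact (((measurableSet_strictPast_lt 0).inter measurableSet_strictPast_lt_top).compl).inter
      (h0 A hA)
  · have : (fun ω => ((τ ω).untopD 0, ω)) ⁻¹' (Ioi t ×ˢ A) =
        {ω | t < (τ ω).untopD 0} ∩ A := by
      ext ω; simp
    rw [this, hlt, inter_right_comm, inter_comm _ A]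
    exact (measurableSet_strictPast_inter_lt hA).inter measurableSet_strictPast_lt_top

end StrictPast

end Measurability

/-! ### Compensation formula for nonnegative functions of the jumps. -/

section SizeLaw

variable {Ω : Type*} [m : MeasurableSpace Ω] {d : ℕ}
  {μ : ℝ≥0 → EuclideanSpace ℝ (Fin d) → EuclideanSpace ℝ (Fin d)}
  {B : Matrix (Fin d) (Fin d) ℝ} {ν : Fin d → Kernel (EuclideanSpace ℝ (Fin d)) ℝ}
  {𝓕 : Filtration ℝ≥0 m} {T : ℕ → Ω → WithTop ℝ≥0} {X : ℕ → Ω → Fin d}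
  {Y : Fin d → ℕ → Ω → ℝ} {Λ : ℝ≥0 → Ω → EuclideanSpace ℝ (Fin d)}
  {P : Measure Ω} {x : EuclideanSpace ℝ (Fin d)}

/-- The left limit of the path at the time of the event with index `n`. -/
noncomputable def preEvent (T : ℕ → Ω → WithTop ℝ≥0) (Λ : ℝ≥0 → Ω → EuclideanSpace ℝ (Fin d))
    (n : ℕ) (ω : Ω) : EuclideanSpace ℝ (Fin d) :=
  Function.leftLim (fun t => Λ t ω) ((T (n + 1) ω).untopD 0)

/-- The events with index `n` and type `k` that take place in the time interval `(s, t]`. -/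
def eventSet (T : ℕ → Ω → WithTop ℝ≥0) (X : ℕ → Ω → Fin d) (k : Fin d) (s t : ℝ≥0) (n : ℕ) :
    Set Ω :=
  ({ω | (s : WithTop ℝ≥0) < T (n + 1) ω} ∩ {ω | T (n + 1) ω ≤ t}) ∩
    {ω | n ∈ eventIndices T X k ω}

namespace IsSelfExciting

lemma measurable_preEvent (h : IsSelfExciting μ B ν 𝓕 T X Y Λ P x) (n : ℕ) :
    Measurable[strictPast 𝓕 (T (n + 1))] (preEvent T Λ n) :=
  (measurable_predictable_leftLim h.intensity_adapted h.intensity_cadlag).comp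
    measurable_strictPast_predictable

lemma measurable_preEvent' (h : IsSelfExciting μ B ν 𝓕 T X Y Λ P x) (n : ℕ) :
    Measurable (preEvent T Λ n) :=
  (h.measurable_preEvent n).mono (strictPast_le (h.time_stopping _)) le_rfl

lemma measurableSet_event_size (h : IsSelfExciting μ B ν 𝓕 T X Y Λ P x) (n : ℕ) (k : Fin d)
    {A : Set ℝ} (hA : MeasurableSet A) :
    MeasurableSet ({ω | n ∈ eventIndices T X k ω} ∩ {ω | Y k (n + 1) ω ∈ A}) := by
  have : {ω | n ∈ eventIndices T X k ω} ∩ {ω | Y k (n + 1) ω ∈ A} =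
      ⋃ j : ℕ, {ω | T (n + 1) ω ≤ ((j : ℝ≥0) : WithTop ℝ≥0) ∧ X (n + 1) ω = k ∧
        Y k (n + 1) ω ∈ A} := by
    ext ω
    simp only [eventIndices, mem_inter_iff, mem_ofPred_eq, mem_iUnion]
    constructor
    · rintro ⟨⟨h1, h2⟩, h3⟩
      obtain ⟨r, hr⟩ := WithTop.ne_top_iff_exists.1 h1.ne
      obtain ⟨j, hj⟩ := exists_nat_ge r
      exact ⟨j, hr ▸ WithTop.coe_le_coe.2 hj, h2, h3⟩
    · rintro ⟨j, h1, h2, h3⟩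
      exact ⟨⟨h1.trans_lt (WithTop.coe_lt_top _), h2⟩, h3⟩
  rw [this]
  exact MeasurableSet.iUnion fun j => 𝓕.le _ _ (h.event_adapted n k A j hA)

lemma measurableSet_event (h : IsSelfExciting μ B ν 𝓕 T X Y Λ P x) (n : ℕ) (k : Fin d) :
    MeasurableSet {ω | n ∈ eventIndices T X k ω} := by
  simpa using h.measurableSet_event_size n k MeasurableSet.univ

/-- The sizes are only observed on their own events, so `Y` itself need not be measurable; its
truncation to the event is. -/
lemma measurable_size (h : IsSelfExciting μ B ν 𝓕 T X Y Λ P x) (n : ℕ) (k : Fin d) :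
    Measurable ({ω | n ∈ eventIndices T X k ω}.indicator (Y k (n + 1))) := by
  intro A hA
  classical
  rw [indicator_preimage, Set.ite]
  refine MeasurableSet.union ?_ ?_
  · rw [inter_comm]; exact h.measurableSet_event_size n k hA
  · exact (measurable_const hA).diff (h.measurableSet_event n k)

lemma measurable_indicator_event (h : IsSelfExciting μ B ν 𝓕 T X Y Λ P x) (n : ℕ) (k : Fin d)
    {φ : EuclideanSpace ℝ (Fin d) × ℝ → ℝ≥0∞} (hφ : Measurable φ) (s t : ℝ≥0) :
    Measurable ((eventSet T X k s t n).indicator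
      fun ω => φ (preEvent T Λ n ω, Y k (n + 1) ω)) := by
  have hE : MeasurableSet (eventSet T X k s t n) :=
    (strictPast_le (h.time_stopping _) _
      ((measurableSet_strictPast_lt s).inter (measurableSet_strictPast_le t))).inter
      (h.measurableSet_event n k)
  have : (eventSet T X k s t n).indicator (fun ω => φ (preEvent T Λ n ω, Y k (n + 1) ω)) =
      (eventSet T X k s t n).indicator fun ω => φ (preEvent T Λ n ω,
        {ω | n ∈ eventIndices T X k ω}.indicator (Y k (n + 1)) ω) := by
    refine indicator_congr fun ω hω => ?_
    rw [indicator_of_mem hω.2]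
  rw [this]
  exact (hφ.comp ((h.measurable_preEvent' n).prodMk (h.measurable_size n k))).indicator hE

variable [hν : ∀ k, IsMarkovKernel (ν k)]

/-- The conditional law of the jump sizes, for functions of the left limit and the jump size. -/
lemma lintegral_size (h : IsSelfExciting μ B ν 𝓕 T X Y Λ P x) (n : ℕ) (k : Fin d)
    {φ : EuclideanSpace ℝ (Fin d) × ℝ → ℝ≥0∞} (hφ : Measurable φ) {F : Set Ω}
    (hF : MeasurableSet[strictPast 𝓕 (T (n + 1))] F) :
    ∫⁻ ω in F ∩ {ω | n ∈ eventIndices T X k ω}, φ (preEvent T Λ n ω, Y k (n + 1) ω) ∂P =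
      ∫⁻ ω in F ∩ {ω | n ∈ eventIndices T X k ω},
        ∫⁻ z, φ (preEvent T Λ n ω, z) ∂(ν k (preEvent T Λ n ω)) ∂P := by
  have := h.isProbabilityMeasure
  set I := {ω | n ∈ eventIndices T X k ω} with hI
  set Y' := I.indicator (Y k (n + 1)) with hY'
  have hIm : MeasurableSet I := h.measurableSet_event n k
  have hFm : MeasurableSet F := strictPast_le (h.time_stopping _) _ hF
  have hV := h.measurable_preEvent' n
  have hY : Measurable Y' := h.measurable_size n k
  -- Rectangles `D × A` determine these measures. On them this is `size_law` for the event
  -- `preEvent⁻¹ D ∩ F`, which lies in the strict past because the left limit process is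
  -- predictable.
  have hlaw : (P.restrict (F ∩ I)).map (fun ω => (preEvent T Λ n ω, Y' ω)) =
      ((P.restrict (F ∩ I)).map (preEvent T Λ n)) ⊗ₘ ν k := by
    refine Measure.ext_prod fun {D A} hD hA => ?_
    rw [Measure.map_apply (hV.prodMk hY) (hD.prod hA), Measure.compProd_apply_prod hD hA,
      setLIntegral_map hD ((ν k).measurable_coe hA) hV,
      Measure.restrict_apply ((hV.prodMk hY) (hD.prod hA)), Measure.restrict_restrict (hV hD)]
    have h1 := h.size_law n k A (preEvent T Λ n ⁻¹' D ∩ F) hA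
      ((h.measurable_preEvent n hD).inter hF)
    rw [← inter_assoc (preEvent T Λ n ⁻¹' D) F I]
    refine Eq.trans (congrArg P ?_) h1
    ext ω
    simp only [mem_inter_iff, mem_preimage, mem_prod, mem_ofPred_eq]
    by_cases hω : ω ∈ I
    · have : Y' ω = Y k (n + 1) ω := indicator_of_mem hω _
      rw [this]
      have hω' : n ∈ eventIndices T X k ω := hω
      tauto
    · have hω' : ¬ n ∈ eventIndices T X k ω := hω
      tauto
  calc _ = ∫⁻ ω in F ∩ I, φ (preEvent T Λ n ω, Y' ω) ∂P := by
        refine setLIntegral_congr_fun (hFm.inter hIm) fun ω hω => ?_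
        simp only [hY', indicator_of_mem hω.2]
    _ = ∫⁻ p, φ p ∂((P.restrict (F ∩ I)).map (fun ω => (preEvent T Λ n ω, Y' ω))) :=
        (lintegral_map hφ (hV.prodMk hY)).symm
    _ = _ := by
        rw [hlaw, Measure.lintegral_compProd hφ, lintegral_map hφ.lintegral_kernel_prod_right' hV]

/-- The compensation formula for the events of type `k` in `(s, t]`. -/
theorem lintegral_tsum_event (h : IsSelfExciting μ B ν 𝓕 T X Y Λ P x) (k : Fin d)
    {φ : EuclideanSpace ℝ (Fin d) × ℝ → ℝ≥0∞} (hφ : Measurable φ) {s t : ℝ≥0} {F : Set Ω}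
    (hF : MeasurableSet[𝓕 s] F) :
    ∫⁻ ω in F, ∑' n, (eventSet T X k s t n).indicator
        (fun ω => φ (preEvent T Λ n ω, Y k (n + 1) ω)) ω ∂P =
      ∫⁻ ω in F, ∫⁻ r in Ioc s t, ENNReal.ofReal (Λ r ω k) *
        ∫⁻ z, φ (Function.leftLim (fun r => Λ r ω) r, z)
          ∂(ν k (Function.leftLim (fun r => Λ r ω) r)) ∂lebesgueTime ∂P := by
  classical
  have := h.isProbabilityMeasure
  have hFm : MeasurableSet F := 𝓕.le _ _ hF
  set L : ℝ≥0 × Ω → EuclideanSpace ℝ (Fin d) :=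
    fun p => Function.leftLim (fun t => Λ t p.2) p.1 with hL
  have hLm : Measurable[𝓕.predictable] L :=
    measurable_predictable_leftLim h.intensity_adapted h.intensity_cadlag
  set Φ : EuclideanSpace ℝ (Fin d) → ℝ≥0∞ := fun y => ∫⁻ z, φ (y, z) ∂(ν k y) with hΦ
  have hΦm : Measurable Φ := hφ.lintegral_kernel_prod_right'
  set H : ℝ≥0 × Ω → ℝ≥0∞ := (Ioc s t ×ˢ F).indicator fun p => Φ (L p) with hH
  have hHm : Measurable[𝓕.predictable] H := by
    change Measurable[𝓕.predictable] ((Ioc s t ×ˢ F).indicator (Φ ∘ L))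
    exact (hΦm.comp hLm).indicator (measurableSet_predictable_Ioc_prod s t hF)
  have hset : ∀ n, F ∩ eventSet T X k s t n =
      ((F ∩ {ω | (s : WithTop ℝ≥0) < T (n + 1) ω}) ∩ {ω | T (n + 1) ω ≤ t}) ∩
        {ω | n ∈ eventIndices T X k ω} := fun n => by
    rw [eventSet, inter_assoc, ← inter_assoc, ← inter_assoc]
  have hpast : ∀ n, MeasurableSet[strictPast 𝓕 (T (n + 1))]
      ((F ∩ {ω | (s : WithTop ℝ≥0) < T (n + 1) ω}) ∩ {ω | T (n + 1) ω ≤ t}) := fun n =>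
    (measurableSet_strictPast_inter_lt hF).inter (measurableSet_strictPast_le t)
  have hEm : ∀ n, MeasurableSet (eventSet T X k s t n) := fun n =>
    (strictPast_le (h.time_stopping _) _
      ((measurableSet_strictPast_lt s).inter (measurableSet_strictPast_le t))).inter
      (h.measurableSet_event n k)
  have hΦV : ∀ n, Measurable ((F ∩ eventSet T X k s t n).indicator
      fun ω => Φ (preEvent T Λ n ω)) := fun n =>
    (hΦm.comp (h.measurable_preEvent' n)).indicator (hFm.inter (hEm n))
  calc _ = ∑' n, ∫⁻ ω in F, (eventSet T X k s t n).indicator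
        (fun ω => φ (preEvent T Λ n ω, Y k (n + 1) ω)) ω ∂P :=
        lintegral_tsum fun n => (h.measurable_indicator_event n k hφ s t).aemeasurable
    _ = ∑' n, ∫⁻ ω, (F ∩ eventSet T X k s t n).indicator (fun ω => Φ (preEvent T Λ n ω)) ω ∂P := by
        refine tsum_congr fun n => ?_
        rw [setLIntegral_indicator (hEm n), lintegral_indicator (hFm.inter (hEm n)),
          inter_comm (eventSet T X k s t n) F, hset n, h.lintegral_size n k hφ (hpast n)]
    _ = ∫⁻ ω, ∑' n, (F ∩ eventSet T X k s t n).indicator (fun ω => Φ (preEvent T Λ n ω)) ω ∂P :=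
        (lintegral_tsum fun n => (hΦV n).aemeasurable).symm
    -- With the sizes averaged out, each term is the predictable `H` at an event time, so the sum is
    -- its integral against `N_k`.
    _ = ∫⁻ ω, ∫⁻ r, H (r, ω) ∂(counting T X k ω) ∂P := by
        refine lintegral_congr fun ω => ?_
        rw [counting, lintegral_sum_measure]
        refine tsum_congr fun n => ?_
        by_cases hn : n ∈ eventIndices T X k ω
        · rw [if_pos hn, lintegral_dirac]
          obtain ⟨r, hr⟩ := WithTop.ne_top_iff_exists.1 hn.1.ne
          have e : (ω ∈ F ∩ eventSet T X k s t n) ↔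
              ((T (n + 1) ω).untopD 0, ω) ∈ Ioc s t ×ˢ F := by
            have e1 : ω ∈ eventSet T X k s t n ↔
                (s : WithTop ℝ≥0) < T (n + 1) ω ∧ T (n + 1) ω ≤ t := by
              simp only [eventSet, mem_inter_iff, mem_ofPred_eq, hn, and_true]
            rw [mem_inter_iff, e1, ← hr, WithTop.untopD_coe, mem_prod, mem_Ioc,
              WithTop.coe_lt_coe, WithTop.coe_le_coe, and_comm]
          by_cases he : ω ∈ F ∩ eventSet T X k s t n
          · rw [hH, indicator_of_mem he, indicator_of_mem (e.1 he)]
            rfl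
          · rw [hH, indicator_of_notMem he, indicator_of_notMem (fun h' => he (e.2 h'))]
        · rw [if_neg hn, lintegral_zero_measure, indicator_of_notMem]
          exact fun h' => hn h'.2.2
    _ = ∫⁻ ω, ∫⁻ r, H (r, ω) * ENNReal.ofReal (Λ r ω k) ∂lebesgueTime ∂P := h.intensity k H hHm
    _ = ∫⁻ ω, F.indicator (fun ω => ∫⁻ r in Ioc s t, ENNReal.ofReal (Λ r ω k) *
          Φ (L (r, ω)) ∂lebesgueTime) ω ∂P := by
        refine lintegral_congr fun ω => ?_
        by_cases hω : ω ∈ F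
        · rw [indicator_of_mem hω, ← lintegral_indicator measurableSet_Ioc]
          refine lintegral_congr fun r => ?_
          by_cases hr : r ∈ Ioc s t
          · rw [hH, indicator_of_mem (show (r, ω) ∈ Ioc s t ×ˢ F from ⟨hr, hω⟩),
              indicator_of_mem hr, mul_comm]
          · rw [hH, indicator_of_notMem (fun h' => hr h'.1), indicator_of_notMem hr, zero_mul]
        · rw [indicator_of_notMem hω]
          refine (lintegral_congr fun r => ?_).trans lintegral_zero
          rw [hH, indicator_of_notMem (fun h' => hω h'.2), zero_mul]
    _ = _ := lintegral_indicator hFm _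

end IsSelfExciting

end SizeLaw

/-! ### Signed increments and their compensator. -/

lemma integrable_of_ae_eq_toReal_sub {α : Type*} [MeasurableSpace α] {ρ : Measure α}
    {p q : α → ℝ≥0∞} (hp : AEMeasurable p ρ) (hq : AEMeasurable q ρ)
    (hp' : ∫⁻ a, p a ∂ρ ≠ ⊤) (hq' : ∫⁻ a, q a ∂ρ ≠ ⊤) {g : α → ℝ}
    (hg : ∀ᵐ a ∂ρ, g a = (p a).toReal - (q a).toReal) :
    Integrable g ρ ∧ ∫ a, g a ∂ρ = (∫⁻ a, p a ∂ρ).toReal - (∫⁻ a, q a ∂ρ).toReal := by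
  have h1 := integrable_toReal_of_lintegral_ne_top hp hp'
  have h2 := integrable_toReal_of_lintegral_ne_top hq hq'
  refine ⟨(h1.sub h2).congr (hg.mono fun a ha => ha.symm), ?_⟩
  rw [integral_congr_ae hg, integral_sub h1 h2, integral_toReal hp (ae_lt_top' hp hp'),
    integral_toReal hq (ae_lt_top' hq hq')]

/-- When `c = 0` the function need not be integrable, but both sides vanish because `0 * ⊤ = 0`;
when `c > 0` the bound forces integrability. -/
lemma mul_integral_eq_toReal_sub {α : Type*} [MeasurableSpace α] {ρ : Measure α} {g : α → ℝ}
    (hg : Measurable g) {c : ℝ} (hc : 0 ≤ c)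
    (h : ENNReal.ofReal c * ∫⁻ a, ‖g a‖ₑ ∂ρ ≠ ⊤) :
    c * ∫ a, g a ∂ρ = (ENNReal.ofReal c * ∫⁻ a, ENNReal.ofReal (g a) ∂ρ).toReal -
      (ENNReal.ofReal c * ∫⁻ a, ENNReal.ofReal (-g a) ∂ρ).toReal := by
  rcases hc.eq_or_lt with rfl | hc'
  · simp
  · have hfin : ∫⁻ a, ‖g a‖ₑ ∂ρ ≠ ⊤ := fun h' => h (by
      rw [h', ENNReal.mul_top (ENNReal.ofReal_pos.2 hc').ne'])
    have hi : Integrable g ρ := ⟨hg.aestronglyMeasurable, lt_top_iff_ne_top.2 hfin⟩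
    rw [integral_eq_lintegral_pos_part_sub_lintegral_neg_part hi, ENNReal.toReal_mul,
      ENNReal.toReal_mul, ENNReal.toReal_ofReal hc, mul_sub]

lemma measurable_uncurry_of_isCadlagPath {Ω : Type*} {m : MeasurableSpace Ω} {E : Type*}
    [TopologicalSpace E] [TopologicalSpace.PseudoMetrizableSpace E] [MeasurableSpace E]
    [BorelSpace E] {Λ : ℝ≥0 → Ω → E} (hΛ : ∀ s, Measurable (Λ s))
    (hcad : ∀ ω, IsCadlagPath fun t => Λ t ω) :
    Measurable fun p : ℝ≥0 × Ω => Λ p.1 p.2 := by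
  refine measurable_of_tendsto_metrizable (f := fun (n : ℕ) (p : ℝ≥0 × Ω) =>
    Λ (min p.1 (n : ℝ≥0)) p.2) (fun n => measurable_uncurry_min (fun s _ => hΛ s) hcad)
    (tendsto_pi_nhds.2 fun p => ?_)
  obtain ⟨N, hN⟩ := exists_nat_ge p.1
  refine tendsto_const_nhds.congr' ?_
  filter_upwards [eventually_ge_atTop N] with n hn
  rw [min_eq_left (hN.trans (Nat.cast_le.2 hn))]

/-- Replacing `s` by `min s t` uses the process up to time `t` only, so the integral is measurable
for the information available at `t`. -/
lemma stronglyMeasurable_integral_comp {Ω : Type*} {m : MeasurableSpace Ω} {E : Type*}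
    [TopologicalSpace E] [TopologicalSpace.PseudoMetrizableSpace E] [MeasurableSpace E]
    [BorelSpace E] {Λ : ℝ≥0 → Ω → E} {t : ℝ≥0} (hΛ : ∀ s ≤ t, Measurable (Λ s))
    (hcad : ∀ ω, IsCadlagPath fun t => Λ t ω) {ψ : ℝ≥0 → E → ℝ}
    (hψ : Measurable (Function.uncurry ψ)) :
    StronglyMeasurable fun ω => ∫ s in Iic t, ψ s (Λ s ω) ∂lebesgueTime := by
  have h1 : Measurable fun p : ℝ≥0 × Ω => ψ p.1 (Λ (min p.1 t) p.2) :=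
    hψ.comp (measurable_fst.prodMk (measurable_uncurry_min hΛ hcad))
  have h2 := h1.stronglyMeasurable.integral_prod_left' (μ := lebesgueTime.restrict (Iic t))
  refine (congrArg (fun g : Ω → ℝ => StronglyMeasurable g) ?_).mp h2
  funext ω
  refine setIntegral_congr_fun measurableSet_Iic fun s hs => ?_
  simp only [min_eq_left (show s ≤ t from hs)]

lemma exists_bound_of_tendsto_top {Ω : Type*} {T : ℕ → Ω → WithTop ℝ≥0} {ω : Ω}
    (h : Tendsto (fun n => T n ω) atTop (𝓝 ⊤)) (t : ℝ≥0) :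
    ∃ N, ∀ n, T (n + 1) ω ≤ t → n < N := by
  obtain ⟨N, hN⟩ := eventually_atTop.1 (h.eventually (lt_mem_nhds (WithTop.coe_lt_top t)))
  exact ⟨N, fun n hn => not_le.1 fun h' => absurd (hN (n + 1) (by omega)) (not_lt.2 hn)⟩

section Compensator

variable {Ω : Type*} [m : MeasurableSpace Ω] {d : ℕ}
  {μ : ℝ≥0 → EuclideanSpace ℝ (Fin d) → EuclideanSpace ℝ (Fin d)}
  {B : Matrix (Fin d) (Fin d) ℝ} {ν : Fin d → Kernel (EuclideanSpace ℝ (Fin d)) ℝ}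
  {𝓕 : Filtration ℝ≥0 m} {T : ℕ → Ω → WithTop ℝ≥0} {X : ℕ → Ω → Fin d}
  {Y : Fin d → ℕ → Ω → ℝ} {Λ : ℝ≥0 → Ω → EuclideanSpace ℝ (Fin d)}
  {P : Measure Ω} {x : EuclideanSpace ℝ (Fin d)} {f : EuclideanSpace ℝ (Fin d) → ℝ}

/-- The increment of `f` when a jump of size `p.2` of type `k` occurs in the state `p.1`. -/
def jumpIncrement (B : Matrix (Fin d) (Fin d) ℝ) (f : EuclideanSpace ℝ (Fin d) → ℝ) (k : Fin d)
    (p : EuclideanSpace ℝ (Fin d) × ℝ) : ℝ :=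
  f (p.1 + p.2 • column B k) - f p.1

lemma measurable_jumpIncrement (hf : Measurable f) (k : Fin d) :
    Measurable (jumpIncrement B f k) :=
  (hf.comp (measurable_fst.add (measurable_snd.smul_const _))).sub (hf.comp measurable_fst)

/-- The sum of the increments of `f` over the events of type `k` in `(s, t]`. -/
noncomputable def jumpTotal (B : Matrix (Fin d) (Fin d) ℝ) (T : ℕ → Ω → WithTop ℝ≥0)
    (X : ℕ → Ω → Fin d) (Y : Fin d → ℕ → Ω → ℝ) (Λ : ℝ≥0 → Ω → EuclideanSpace ℝ (Fin d))
    (f : EuclideanSpace ℝ (Fin d) → ℝ) (k : Fin d) (s t : ℝ≥0) (ω : Ω) : ℝ :=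
  ∑' n, (eventSet T X k s t n).indicator
    (fun ω => jumpIncrement B f k (preEvent T Λ n ω, Y k (n + 1) ω)) ω

/-- The compensator of `jumpTotal`. -/
noncomputable def jumpCompensator (B : Matrix (Fin d) (Fin d) ℝ)
    (ν : Fin d → Kernel (EuclideanSpace ℝ (Fin d)) ℝ)
    (Λ : ℝ≥0 → Ω → EuclideanSpace ℝ (Fin d))
    (f : EuclideanSpace ℝ (Fin d) → ℝ) (k : Fin d) (s t : ℝ≥0) (ω : Ω) : ℝ :=
  ∫ r in Ioc s t, Λ r ω k * jumpOperator B ν f k (Function.leftLim (fun r => Λ r ω) r)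
    ∂lebesgueTime

namespace IsSelfExciting

variable [hν : ∀ k, IsMarkovKernel (ν k)]

lemma measurable_rate (h : IsSelfExciting μ B ν 𝓕 T X Y Λ P x) (k : Fin d)
    {φ : EuclideanSpace ℝ (Fin d) × ℝ → ℝ≥0∞} (hφ : Measurable φ) :
    Measurable fun p : ℝ≥0 × Ω => ENNReal.ofReal (Λ p.1 p.2 k) *
        ∫⁻ z, φ (Function.leftLim (fun r => Λ r p.2) p.1, z)
          ∂(ν k (Function.leftLim (fun r => Λ r p.2) p.1)) := by
  have hL : Measurable fun p : ℝ≥0 × Ω => Function.leftLim (fun t => Λ t p.2) p.1 :=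
    (measurable_predictable_leftLim h.intensity_adapted h.intensity_cadlag).mono
      predictable_le_prod le_rfl
  have hΛ : Measurable fun p : ℝ≥0 × Ω => Λ p.1 p.2 :=
    measurable_uncurry_of_isCadlagPath
      (fun s => (h.intensity_adapted s).mono (𝓕.le s) le_rfl) h.intensity_cadlag
  have hΛk : Measurable fun p : ℝ≥0 × Ω => Λ p.1 p.2 k :=
    (EuclideanSpace.proj (𝕜 := ℝ) k).continuous.measurable.comp hΛ
  have hΦ : Measurable fun y => ∫⁻ z, φ (y, z) ∂(ν k y) := hφ.lintegral_kernel_prod_right'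
  exact (hΛk.ennreal_ofReal).mul (hΦ.comp hL)

/-- The sum of the increments of `f` over the events of type `k` and its compensator. -/
theorem compensation (h : IsSelfExciting μ B ν 𝓕 T X Y Λ P x) (hf : Measurable f) (k : Fin d)
    {s t : ℝ≥0} (ht : expectedJumpTerm B ν Λ f P t < ⊤) :
    (∀ᵐ ω ∂P, IntegrableOn (fun r => Λ r ω k *
      jumpOperator B ν f k (Function.leftLim (fun r => Λ r ω) r)) (Ioc s t) lebesgueTime) ∧
    Integrable (jumpTotal B T X Y Λ f k s t) P ∧
    Integrable (jumpCompensator B ν Λ f k s t) P ∧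
    ∀ F, MeasurableSet[𝓕 s] F → ∫ ω in F, jumpTotal B T X Y Λ f k s t ω ∂P =
      ∫ ω in F, jumpCompensator B ν Λ f k s t ω ∂P := by
  have := h.isProbabilityMeasure
  set g := jumpIncrement B f k with hg
  have hgm : Measurable g := measurable_jumpIncrement hf k
  -- positive and negative parts of the rate, its time integral, and the sum over the events
  set L : ℝ≥0 × Ω → EuclideanSpace ℝ (Fin d) :=
    fun p => Function.leftLim (fun t => Λ t p.2) p.1 with hL
  let rate (φ : EuclideanSpace ℝ (Fin d) × ℝ → ℝ≥0∞) (p : ℝ≥0 × Ω) : ℝ≥0∞ :=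
    ENNReal.ofReal (Λ p.1 p.2 k) * ∫⁻ z, φ (L p, z) ∂(ν k (L p))
  let c (φ : EuclideanSpace ℝ (Fin d) × ℝ → ℝ≥0∞) (ω : Ω) : ℝ≥0∞ :=
    ∫⁻ r in Ioc s t, rate φ (r, ω) ∂lebesgueTime
  let a (φ : EuclideanSpace ℝ (Fin d) × ℝ → ℝ≥0∞) (ω : Ω) : ℝ≥0∞ :=
    ∑' n, (eventSet T X k s t n).indicator (fun ω => φ (preEvent T Λ n ω, Y k (n + 1) ω)) ω
  have hrate : ∀ {φ}, Measurable φ → Measurable (rate φ) := fun hφ => h.measurable_rate k hφ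
  have hcm : ∀ {φ}, Measurable φ → Measurable (c φ) := fun hφ =>
    (hrate hφ).lintegral_prod_left'
  have ham : ∀ {φ}, Measurable φ → Measurable (a φ) := fun hφ =>
    Measurable.tsum fun n => h.measurable_indicator_event n k hφ s t
  have hac : ∀ {φ}, Measurable φ → ∀ {F}, MeasurableSet[𝓕 s] F →
      ∫⁻ ω in F, a φ ω ∂P = ∫⁻ ω in F, c φ ω ∂P := by
    intro φ hφ F hF
    exact h.lintegral_tsum_event k hφ hF
  set φ₀ : EuclideanSpace ℝ (Fin d) × ℝ → ℝ≥0∞ := fun p => ‖g p‖ₑ with hφ₀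
  set φ₁ : EuclideanSpace ℝ (Fin d) × ℝ → ℝ≥0∞ := fun p => ENNReal.ofReal (g p) with hφ₁
  set φ₂ : EuclideanSpace ℝ (Fin d) × ℝ → ℝ≥0∞ := fun p => ENNReal.ofReal (-g p) with hφ₂
  have m0 : Measurable φ₀ := hgm.enorm
  have m1 : Measurable φ₁ := hgm.ennreal_ofReal
  have m2 : Measurable φ₂ := hgm.neg.ennreal_ofReal
  have le1 : ∀ p, φ₁ p ≤ φ₀ p := fun p =>
    (ENNReal.ofReal_le_ofReal (le_abs_self (g p))).trans_eq (ofReal_norm (g p))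
  have le2 : ∀ p, φ₂ p ≤ φ₀ p := fun p =>
    (ENNReal.ofReal_le_ofReal (neg_le_abs (g p))).trans_eq (ofReal_norm (g p))
  have hc0 : ∫⁻ ω, c φ₀ ω ∂P ≠ ⊤ := by
    refine (lt_of_le_of_lt ?_ ht).ne
    refine lintegral_mono fun ω => ?_
    refine (lintegral_mono_set Ioc_subset_Iic_self).trans (lintegral_mono fun r => ?_)
    exact Finset.single_le_sum (f := fun k => ENNReal.ofReal (Λ r ω k) *
      ∫⁻ z, ‖f (L (r, ω) + z • column B k) - f (L (r, ω))‖ₑ ∂(ν k (L (r, ω))))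
      (fun _ _ => zero_le) (Finset.mem_univ k)
  have cle : ∀ {φ}, (∀ p, φ p ≤ φ₀ p) → ∀ ω, c φ ω ≤ c φ₀ ω := fun hφ ω =>
    lintegral_mono fun r => mul_le_mul_right (lintegral_mono fun z => hφ _) _
  have hcF : ∀ {φ}, (∀ p, φ p ≤ φ₀ p) → ∀ F : Set Ω, ∫⁻ ω in F, c φ ω ∂P ≠ ⊤ := fun hφ F =>
    ne_top_of_le_ne_top hc0 ((lintegral_mono (cle hφ)).trans (setLIntegral_le_lintegral _ _))
  have hc0' : ∀ᵐ ω ∂P, c φ₀ ω < ⊤ := ae_lt_top (hcm m0) hc0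
  have hcomp : ∀ᵐ ω ∂P, IntegrableOn (fun r => Λ r ω k *
      jumpOperator B ν f k (Function.leftLim (fun r => Λ r ω) r)) (Ioc s t) lebesgueTime ∧
      jumpCompensator B ν Λ f k s t ω = (c φ₁ ω).toReal - (c φ₂ ω).toReal := by
    filter_upwards [hc0', h.intensity_nonneg] with ω hω hpos
    have hsec : ∀ {φ}, Measurable φ → Measurable fun r => rate φ (r, ω) := fun hφ =>
      (hrate hφ).comp measurable_prodMk_right
    refine integrable_of_ae_eq_toReal_sub (hsec m1).aemeasurable (hsec m2).aemeasurable
      ((cle le1 ω).trans_lt hω).ne ((cle le2 ω).trans_lt hω).ne ?_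
    filter_upwards [ae_lt_top (hsec m0) hω.ne] with r hr
    exact mul_integral_eq_toReal_sub (g := fun z => g (L (r, ω), z))
      (hgm.comp measurable_prodMk_left) (hpos r k) hr.ne
  -- Only finitely many events occur before `t`, so positive and negative parts can be summed
  -- separately, with no appeal to the moment bound.
  have htot : ∀ᵐ ω ∂P, jumpTotal B T X Y Λ f k s t ω = (a φ₁ ω).toReal - (a φ₂ ω).toReal := by
    filter_upwards [h.time_tendsto] with ω hω
    obtain ⟨N, hN⟩ := exists_bound_of_tendsto_top hω t
    have hzero : ∀ n, n ∉ Finset.range N → ω ∉ eventSet T X k s t n := fun n hn h' =>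
      hn (Finset.mem_range.2 (hN n h'.1.2))
    have hfin : ∀ φ : EuclideanSpace ℝ (Fin d) × ℝ → ℝ≥0∞, (∀ p, φ p ≠ ⊤) →
        (a φ ω).toReal = ∑ n ∈ Finset.range N, ((eventSet T X k s t n).indicator
          (fun ω => φ (preEvent T Λ n ω, Y k (n + 1) ω)) ω).toReal := by
      intro φ hφ
      simp only [a]
      rw [tsum_eq_sum fun n hn => indicator_of_notMem (hzero n hn) _, ENNReal.toReal_sum]
      intro n _
      by_cases hn : ω ∈ eventSet T X k s t n
      · rw [indicator_of_mem hn]; exact hφ _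
      · rw [indicator_of_notMem hn]; exact ENNReal.zero_ne_top
    rw [hfin φ₁ fun p => ENNReal.ofReal_ne_top, hfin φ₂ fun p => ENNReal.ofReal_ne_top, jumpTotal,
      tsum_eq_sum fun n hn => indicator_of_notMem (hzero n hn) _, ← Finset.sum_sub_distrib]
    refine Finset.sum_congr rfl fun n _ => ?_
    by_cases hn : ω ∈ eventSet T X k s t n
    · simp only [indicator_of_mem hn, hφ₁, hφ₂, ENNReal.toReal_ofReal']
      exact (max_zero_sub_max_neg_zero_eq_self _).symm
    · simp [indicator_of_notMem hn]
  -- The sums over events inherit finite expectations, and equal integrals over `F`, from the time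
  -- integrals through `hac`.
  have hA : ∀ F, MeasurableSet[𝓕 s] F →
      IntegrableOn (jumpTotal B T X Y Λ f k s t) F P ∧
      ∫ ω in F, jumpTotal B T X Y Λ f k s t ω ∂P =
        (∫⁻ ω in F, c φ₁ ω ∂P).toReal - (∫⁻ ω in F, c φ₂ ω ∂P).toReal := by
    intro F hF
    rw [← hac m1 hF, ← hac m2 hF]
    exact integrable_of_ae_eq_toReal_sub (ham m1).aemeasurable (ham m2).aemeasurable
      (hac m1 hF ▸ hcF le1 F) (hac m2 hF ▸ hcF le2 F) (ae_restrict_of_ae htot)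
  have hC : ∀ F : Set Ω, IntegrableOn (jumpCompensator B ν Λ f k s t) F P ∧
      ∫ ω in F, jumpCompensator B ν Λ f k s t ω ∂P =
        (∫⁻ ω in F, c φ₁ ω ∂P).toReal - (∫⁻ ω in F, c φ₂ ω ∂P).toReal := fun F =>
    integrable_of_ae_eq_toReal_sub (hcm m1).aemeasurable (hcm m2).aemeasurable
      (hcF le1 F) (hcF le2 F) (ae_restrict_of_ae (hcomp.mono fun ω hω => hω.2))
  exact ⟨hcomp.mono fun ω hω => hω.1, integrableOn_univ.1 (hA univ .univ).1,
    integrableOn_univ.1 (hC univ).1, fun F hF => (hA F hF).2.trans (hC F).2.symm⟩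

end IsSelfExciting

end Compensator

/-! ### Geometry of the orthant and regularity of the generator. -/

section Orthant

variable {d : ℕ}

lemma convex_orthant : Convex ℝ (orthant d) := by
  intro x hx y hy a b ha hb _ i
  simpa using add_nonneg (mul_nonneg ha (hx i)) (mul_nonneg hb (hy i))

lemma isClosed_orthant : IsClosed (orthant d) := by
  have : orthant d = ⋂ i, {x | 0 ≤ x i} := by ext; simp [orthant]
  rw [this]
  exact isClosed_iInter fun i =>
    isClosed_le continuous_const (EuclideanSpace.proj (𝕜 := ℝ) i).continuous

lemma uniqueDiffOn_orthant : UniqueDiffOn ℝ (orthant d) := by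
  refine uniqueDiffOn_convex convex_orthant ⟨WithLp.toLp 2 fun _ => 1, ?_⟩
  have hopen : IsOpen {x : EuclideanSpace ℝ (Fin d) | ∀ i, 0 < x i} := by
    have : {x : EuclideanSpace ℝ (Fin d) | ∀ i, 0 < x i} = ⋂ i, {x | 0 < x i} := by ext; simp
    rw [this]
    exact isOpen_iInter_of_finite fun i =>
      isOpen_lt continuous_const (EuclideanSpace.proj (𝕜 := ℝ) i).continuous
  exact mem_interior.2 ⟨_, fun x hx i => (hx i).le, hopen, fun i => one_pos⟩

lemma inner_gradientWithin (f : EuclideanSpace ℝ (Fin d) → ℝ) (y v : EuclideanSpace ℝ (Fin d)) :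
    inner ℝ v (gradientWithin f (orthant d) y) = fderivWithin ℝ f (orthant d) y v := by
  rw [real_inner_comm, gradientWithin, InnerProductSpace.toDual_symm_apply]

/-- The gradient is continuous on the closed orthant and, by the default value of `fderivWithin` off
the closure, zero outside it. -/
lemma measurable_gradientWithin_orthant {f : EuclideanSpace ℝ (Fin d) → ℝ}
    (hf : ContDiffOn ℝ 1 f (orthant d)) : Measurable (gradientWithin f (orthant d)) := by
  have hc : ContinuousOn (gradientWithin f (orthant d)) (orthant d) :=
    (InnerProductSpace.toDual ℝ (EuclideanSpace ℝ (Fin d))).symm.continuous.comp_continuousOn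
      (hf.continuousOn_fderivWithin uniqueDiffOn_orthant le_rfl)
  refine measurable_of_restrict_of_restrict_compl isClosed_orthant.measurableSet
    (continuousOn_iff_continuous_domRestrict.1 hc).measurable ?_
  have : (orthant d)ᶜ.domRestrict (gradientWithin f (orthant d)) = fun _ => 0 := by
    funext ⟨y, hy⟩
    rw [domRestrict_apply, gradientWithin, fderivWithin_zero_of_notMem_closure
      (by rwa [isClosed_orthant.closure_eq]), map_zero]
  rw [this]
  exact measurable_const

lemma measurable_generator {μ : ℝ≥0 → EuclideanSpace ℝ (Fin d) → EuclideanSpace ℝ (Fin d)}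
    (hμ : Measurable (Function.uncurry μ)) (B : Matrix (Fin d) (Fin d) ℝ)
    (ν : Fin d → Kernel (EuclideanSpace ℝ (Fin d)) ℝ) [∀ k, IsMarkovKernel (ν k)]
    {f : EuclideanSpace ℝ (Fin d) → ℝ} (hf : Measurable f) (hf1 : ContDiffOn ℝ 1 f (orthant d)) :
    Measurable (Function.uncurry (generator μ B ν f)) := by
  have hJ : ∀ k, Measurable (jumpOperator B ν f k) := fun k =>
    ((measurable_jumpIncrement (B := B) hf k).stronglyMeasurable.integral_kernel_prod_right'
      (κ := ν k)).measurable
  refine (hμ.inner ((measurable_gradientWithin_orthant hf1).comp measurable_snd)).add ?_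
  refine Finset.measurable_sum _ fun k _ => ?_
  exact ((EuclideanSpace.proj (𝕜 := ℝ) k).continuous.measurable.comp measurable_snd).mul
    ((hJ k).comp measurable_snd)

/-- `f` is known to be continuous only on the orthant; its closedness keeps the left limits of the
path there. -/
lemma isCadlagPath_compensated {f : EuclideanSpace ℝ (Fin d) → ℝ}
    {g : ℝ≥0 → EuclideanSpace ℝ (Fin d)} {b : ℝ≥0 → ℝ}
    (hf1 : ContDiffOn ℝ 1 f (orthant d)) (hg : IsCadlagPath g) (hpos : ∀ t, g t ∈ orthant d)
    (hb : ∀ t, IntegrableOn b (Iic t) lebesgueTime) :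
    IsCadlagPath fun t => f (g t) - f (g 0) - ∫ s in Iic t, b s ∂lebesgueTime := by
  intro t
  have hI := continuous_setIntegral_Iic_lebesgueTime hb
  have aux : ∀ {F : Filter ℝ≥0} {y}, y ∈ orthant d → Tendsto g F (𝓝 y) →
      Tendsto (fun t => f (g t)) F (𝓝 (f y)) := fun hy hF =>
    (hf1.continuousOn _ hy).tendsto.comp
      (tendsto_nhdsWithin_iff.2 ⟨hF, Eventually.of_forall hpos⟩)
  refine ⟨((aux (hpos t) (hg t).1).sub_const _).sub hI.continuousWithinAt, ?_⟩
  rcases eq_or_neBot (𝓝[<] t) with hbot | hbot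
  · exact ⟨0, by simp [hbot]⟩
  · obtain ⟨l, hl⟩ := (hg t).2
    have hlo : l ∈ orthant d :=
      isClosed_orthant.mem_of_tendsto hl (Eventually.of_forall hpos)
    exact ⟨_, ((aux hlo hl).sub_const _).sub (hI.continuousWithinAt (s := Iio t))⟩

end Orthant

/-! ### Pathwise decomposition and the martingale property. -/

section Main

variable {Ω : Type*} [m : MeasurableSpace Ω] {d : ℕ}
  {μ : ℝ≥0 → EuclideanSpace ℝ (Fin d) → EuclideanSpace ℝ (Fin d)}
  {B : Matrix (Fin d) (Fin d) ℝ} {ν : Fin d → Kernel (EuclideanSpace ℝ (Fin d)) ℝ}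
  {𝓕 : Filtration ℝ≥0 m} {T : ℕ → Ω → WithTop ℝ≥0} {X : ℕ → Ω → Fin d}
  {Y : Fin d → ℕ → Ω → ℝ} {Λ : ℝ≥0 → Ω → EuclideanSpace ℝ (Fin d)}
  {P : Measure Ω} {x : EuclideanSpace ℝ (Fin d)} {f : EuclideanSpace ℝ (Fin d) → ℝ}

namespace IsSelfExciting

/-- Each event has exactly one type, so the sum over types collapses to the single jump `Y • b_k`
with `k` the type of that event. -/
lemma ae_isJumpPath (h : IsSelfExciting μ B ν 𝓕 T X Y Λ P x) :
    ∀ᵐ ω ∂P, IsJumpPath (fun n => T n ω)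
      (fun n => Y (X (n + 1) ω) (n + 1) ω • column B (X (n + 1) ω))
      (fun s => μ s (Λ s ω)) (fun t => Λ t ω) := by
  filter_upwards [h.time_zero, h.time_mono, h.time_strict, h.time_tendsto, h.drift_integrable,
    h.sde] with ω h0 h1 h2 h3 h4 h5
  refine ⟨h0, h1, h2, h3, h4, fun t => ?_⟩
  rw [h5 t]
  congr 1
  obtain ⟨N, hN⟩ := exists_bound_of_tendsto_top h3 t
  rw [tsum_eq_sum (s := Finset.range N) fun n hn =>
    if_neg fun h' => hn (Finset.mem_range.2 (hN n h'))]
  have : ∀ k, jumpSum T X Y k t ω = ∑ n ∈ Finset.range N,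
      if T (n + 1) ω ≤ t ∧ X (n + 1) ω = k then Y k (n + 1) ω else 0 := fun k =>
    tsum_eq_sum fun n hn => if_neg fun h' => hn (Finset.mem_range.2 (hN n h'.1))
  simp_rw [this, Finset.sum_smul]
  rw [Finset.sum_comm]
  refine Finset.sum_congr rfl fun n _ => ?_
  rw [Finset.sum_eq_single (X (n + 1) ω)]
  · by_cases hn : T (n + 1) ω ≤ t
    · rw [if_pos ⟨hn, rfl⟩, if_pos hn]
    · rw [if_neg fun h' => hn h'.1, if_neg hn, zero_smul]
  · intro k _ hk
    rw [if_neg (fun h' => hk h'.2.symm), zero_smul]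
  · simp

variable [hν : ∀ k, IsMarkovKernel (ν k)]

/-- Along almost every path, the generator is integrable, and the increments of the compensated
process are the compensated sums of the increments of `f`. -/
lemma ae_path (h : IsSelfExciting μ B ν 𝓕 T X Y Λ P x) (hμ : Measurable (Function.uncurry μ))
    (hf : Measurable f) (hf1 : ContDiffOn ℝ 1 f (orthant d))
    (hφ : ∀ t : ℝ≥0, 0 < t → expectedJumpTerm B ν Λ f P t < ⊤) :
    ∀ᵐ ω ∂P, (∀ t, IntegrableOn (fun s => generator μ B ν f s (Λ s ω)) (Iic t) lebesgueTime) ∧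
      ∀ s t, s ≤ t → f (Λ t ω) - f (Λ s ω) - ∫ r in Ioc s t, generator μ B ν f r (Λ r ω)
        ∂lebesgueTime =
        ∑ k, (jumpTotal B T X Y Λ f k s t ω - jumpCompensator B ν Λ f k s t ω) := by
  -- Countably many horizons give one null set for all times; `n + 1` keeps them positive, as the
  -- moment hypothesis requires.
  have hcomp : ∀ᵐ ω ∂P, ∀ (n : ℕ) (k : Fin d), IntegrableOn (fun r => Λ r ω k *
      jumpOperator B ν f k (Function.leftLim (fun r => Λ r ω) r)) (Ioc 0 (n + 1)) lebesgueTime :=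
    ae_all_iff.2 fun n => ae_all_iff.2 fun k => (h.compensation hf k (hφ (n + 1) (by positivity))).1
  filter_upwards [hcomp, h.ae_isJumpPath, h.intensity_nonneg] with ω hω hpath hpos
  have hL := hpath.ae_leftLim_eq
  have hJL : ∀ t k, IntegrableOn (fun r => Λ r ω k *
      jumpOperator B ν f k (Function.leftLim (fun r => Λ r ω) r)) (Iic t) lebesgueTime := by
    intro t k
    obtain ⟨n, hn⟩ := exists_nat_ge t
    have h1 : (Iic t : Set ℝ≥0) =ᵐ[lebesgueTime] Ioc 0 t := by
      have : (Iic t : Set ℝ≥0) = Icc 0 t := by ext; simp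
      rw [this]; exact Ioc_ae_eq_Icc.symm
    exact ((hω n k).mono_set (Ioc_subset_Ioc_right (hn.trans (by simp)))).congr_set_ae h1
  have hJ : ∀ t k, IntegrableOn (fun r => Λ r ω k * jumpOperator B ν f k (Λ r ω))
      (Iic t) lebesgueTime := fun t k =>
    (hJL t k).congr (ae_restrict_of_ae (hL.mono fun r hr => by simp only [hr]))
  have hΛm : Measurable fun r => Λ r ω :=
    (measurable_uncurry_of_isCadlagPath (fun s => (h.intensity_adapted s).mono (𝓕.le s) le_rfl)
      h.intensity_cadlag).comp measurable_prodMk_right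
  have hDm : Measurable fun r => fderivWithin ℝ f (orthant d) (Λ r ω) (μ r (Λ r ω)) := by
    simp_rw [← inner_gradientWithin]
    exact (hμ.comp (measurable_id.prodMk hΛm)).inner
      ((measurable_gradientWithin_orthant hf1).comp hΛm)
  have hD := hpath.integrableOn_fderivWithin (h.intensity_cadlag ω) isClosed_orthant
    uniqueDiffOn_orthant hf1 hpos hDm.aestronglyMeasurable
  have hgen : ∀ r, generator μ B ν f r (Λ r ω) =
      fderivWithin ℝ f (orthant d) (Λ r ω) (μ r (Λ r ω)) +
        ∑ k, Λ r ω k * jumpOperator B ν f k (Λ r ω) := fun r => by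
    rw [generator, inner_gradientWithin]
  simp_rw [hgen]
  refine ⟨fun t => (hD t).add (integrable_finsetSum _ fun k _ => hJ t k), fun s t hst => ?_⟩
  have hcov := hpath.change_of_variables convex_orthant isClosed_orthant uniqueDiffOn_orthant hf1
    hpos hD
  rw [integral_add ((hD t).mono_set Ioc_subset_Iic_self)
    (integrable_finsetSum _ fun k _ => (hJ t k).mono_set Ioc_subset_Iic_self),
    integral_finsetSum _ fun k _ => (hJ t k).mono_set Ioc_subset_Iic_self,
    Finset.sum_sub_distrib]
  have hcompk : ∀ k, jumpCompensator B ν Λ f k s t ω =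
      ∫ r in Ioc s t, Λ r ω k * jumpOperator B ν f k (Λ r ω) ∂lebesgueTime := fun k =>
    integral_congr_ae (ae_restrict_of_ae (hL.mono fun r hr => by simp only [hr]))
  simp_rw [hcompk]
  obtain ⟨N, hN⟩ := exists_bound_of_tendsto_top hpath.tendsto t
  set c : ℕ → ℝ := fun n => f (preEvent T Λ n ω +
    Y (X (n + 1) ω) (n + 1) ω • column B (X (n + 1) ω)) - f (preEvent T Λ n ω) with hc
  have hsum : ∀ u ≤ t, (∑' n, if T (n + 1) ω ≤ u then c n else 0) =
      ∑ n ∈ Finset.range N, if T (n + 1) ω ≤ u then c n else 0 := fun u hu =>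
    tsum_eq_sum fun n hn => if_neg fun h' => hn (Finset.mem_range.2
      (hN n (h'.trans (WithTop.coe_le_coe.2 hu))))
  -- Summing over types recovers all events in `(s, t]`, as the difference of the sums up to `t` and
  -- up to `s`.
  have htot : ∑ k, jumpTotal B T X Y Λ f k s t ω =
      (∑' n, if T (n + 1) ω ≤ t then c n else 0) - ∑' n, if T (n + 1) ω ≤ s then c n else 0 := by
    have hk : ∀ k, jumpTotal B T X Y Λ f k s t ω = ∑ n ∈ Finset.range N,
        (eventSet T X k s t n).indicator
          (fun ω => jumpIncrement B f k (preEvent T Λ n ω, Y k (n + 1) ω)) ω := fun k =>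
      tsum_eq_sum fun n hn => indicator_of_notMem (fun h' => hn (Finset.mem_range.2
        (hN n h'.1.2))) _
    rw [hsum t le_rfl, hsum s hst, ← Finset.sum_sub_distrib]
    simp_rw [hk]
    rw [Finset.sum_comm]
    refine Finset.sum_congr rfl fun n _ => ?_
    rw [Finset.sum_eq_single (X (n + 1) ω)]
    · by_cases h1 : T (n + 1) ω ≤ s
      · have h2 : T (n + 1) ω ≤ t := h1.trans (WithTop.coe_le_coe.2 hst)
        rw [if_pos h1, if_pos h2, sub_self, indicator_of_notMem]
        exact fun h' => absurd h1 (not_le.2 h'.1.1)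
      · by_cases h2 : T (n + 1) ω ≤ t
        · rw [if_neg h1, if_pos h2, sub_zero, indicator_of_mem]
          · rfl
          · exact ⟨⟨not_le.1 h1, h2⟩, h2.trans_lt (WithTop.coe_lt_top t), rfl⟩
        · rw [if_neg h1, if_neg h2, sub_zero, indicator_of_notMem]
          exact fun h' => h2 h'.1.2
    · intro k _ hk
      exact indicator_of_notMem (fun h' => hk h'.2.2.symm) _
    · simp
  have ht := hcov t
  have hs := hcov s
  rw [setIntegral_Iic_sub_lebesgueTime hst (hD t)] at ht
  change _ = _ + ∑' n, (if T (n + 1) ω ≤ t then c n else 0) at ht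
  change _ = _ + ∑' n, (if T (n + 1) ω ≤ s then c n else 0) at hs
  rw [htot]
  linarith

/-- The compensated process is a martingale. -/
theorem martingale_compensated (h : IsSelfExciting μ B ν 𝓕 T X Y Λ P x)
    (hΛ : ∀ t, StronglyMeasurable (Λ t)) (hμ : Measurable (Function.uncurry μ))
    (hf : Measurable f) (hf1 : ContDiffOn ℝ 1 f (orthant d))
    (hφ : ∀ t : ℝ≥0, 0 < t → expectedJumpTerm B ν Λ f P t < ⊤) :
    Martingale (fun t ω => f (Λ t ω) - f (Λ 0 ω) -
      ∫ s in Iic t, generator μ B ν f s (Λ s ω) ∂lebesgueTime) (Filtration.natural Λ hΛ) P := by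
  have := h.isProbabilityMeasure
  set 𝓖 := Filtration.natural Λ hΛ with h𝓖
  set C : ℝ≥0 → Ω → ℝ := fun t ω => f (Λ t ω) - f (Λ 0 ω) -
      ∫ s in Iic t, generator μ B ν f s (Λ s ω) ∂lebesgueTime with hC
  have hΛ𝓖 : ∀ s t, s ≤ t → Measurable[𝓖 t] (Λ s) := fun s t hst =>
    ((Filtration.stronglyAdapted_natural hΛ).stronglyMeasurable_le hst).measurable
  have h𝓖𝓕 : ∀ s, 𝓖 s ≤ 𝓕 s := fun s => iSup₂_le fun r hr =>
    ((h.intensity_adapted r).mono (𝓕.mono hr) le_rfl).comap_le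
  have hadapted : StronglyAdapted 𝓖 C := fun t =>
    (((hf.comp (hΛ𝓖 t t le_rfl)).sub (hf.comp (hΛ𝓖 0 t zero_le))).stronglyMeasurable).sub
      (stronglyMeasurable_integral_comp (m := 𝓖 t) (fun s hs => hΛ𝓖 s t hs) h.intensity_cadlag
        (measurable_generator hμ B ν hf hf1))
  have hpath := h.ae_path hμ hf hf1 hφ
  have hincr : ∀ s t, s ≤ t → ∀ᵐ ω ∂P, C t ω - C s ω =
      ∑ k, (jumpTotal B T X Y Λ f k s t ω - jumpCompensator B ν Λ f k s t ω) := by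
    intro s t hst
    filter_upwards [hpath] with ω hω
    rw [← hω.2 s t hst]
    simp only [hC]
    rw [setIntegral_Iic_sub_lebesgueTime hst (hω.1 t)]
    ring
  have hfin : ∀ t, expectedJumpTerm B ν Λ f P t < ⊤ := fun t =>
    lt_of_le_of_lt (lintegral_mono fun ω => lintegral_mono_set
      (Iic_subset_Iic.2 (le_add_of_nonneg_right zero_le))) (hφ (t + 1) (by positivity))
  have hcompi : ∀ s t k, Integrable (fun ω => jumpTotal B T X Y Λ f k s t ω -
      jumpCompensator B ν Λ f k s t ω) P := fun s t k =>
    (h.compensation hf k (hfin t)).2.1.sub (h.compensation hf k (hfin t)).2.2.1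
  have hC0 : ∀ ω, C 0 ω = 0 := fun ω => by
    simp only [hC]
    rw [setIntegral_Iic_lebesgueTime]
    simp
  -- `f(Λ(t))` itself is not known to be integrable; `C t` is, as its increment from `C 0 = 0` is a
  -- sum of integrable compensated jump sums.
  have hint : ∀ t, Integrable (C t) P := fun t =>
    (integrable_finsetSum Finset.univ fun k _ => hcompi 0 t k).congr
      ((hincr 0 t zero_le).mono fun ω hω => by rw [hC0, sub_zero] at hω; exact hω.symm)
  refine ⟨hadapted, fun s t hst => ?_⟩
  refine (ae_eq_condExp_of_forall_setIntegral_eq (𝓖.le s) (hint t)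
    (fun F _ _ => (hint s).integrableOn) (fun F hF _ => ?_)
    (hadapted s).aestronglyMeasurable).symm
  have hz : ∫ ω in F, (C t ω - C s ω) ∂P = 0 := by
    rw [integral_congr_ae (ae_restrict_of_ae (hincr s t hst)),
      integral_finsetSum _ fun k _ => (hcompi s t k).integrableOn]
    refine Finset.sum_eq_zero fun k _ => ?_
    obtain ⟨-, h1, h2, h3⟩ := h.compensation hf k (s := s) (hfin t)
    -- An event of the natural filtration at `s` is in `𝓕 s`, so the compensation identity applies
    -- to it.
    rw [integral_sub h1.integrableOn h2.integrableOn, h3 F (h𝓖𝓕 s F hF), sub_self]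
  rw [integral_sub (hint t).integrableOn (hint s).integrableOn] at hz
  linarith

end IsSelfExciting

end Main

end SelfExciting

theorem mainTheorem3 {Ω : Type*} [m : MeasurableSpace Ω] {d : ℕ}
    (μ : ℝ≥0 → EuclideanSpace ℝ (Fin d) → EuclideanSpace ℝ (Fin d))
    (hμ : Measurable (Function.uncurry μ))
    (B : Matrix (Fin d) (Fin d) ℝ)
    (ν : Fin d → Kernel (EuclideanSpace ℝ (Fin d)) ℝ) (hν : ∀ k, IsMarkovKernel (ν k))
    (𝓕 : Filtration ℝ≥0 m) (T : ℕ → Ω → WithTop ℝ≥0) (X : ℕ → Ω → Fin d)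
    (Y : Fin d → ℕ → Ω → ℝ) (Λ : ℝ≥0 → Ω → EuclideanSpace ℝ (Fin d))
    (hΛ : ∀ t, StronglyMeasurable (Λ t))
    (S : Set (EuclideanSpace ℝ (Fin d))) (hS : S ⊆ SelfExciting.orthant d)
    (P : EuclideanSpace ℝ (Fin d) → Measure Ω)
    (hP : ∀ x ∈ S, SelfExciting.IsSelfExciting μ B ν 𝓕 T X Y Λ (P x) x)
    (f : EuclideanSpace ℝ (Fin d) → ℝ) (hf : Measurable f)
    (hf1 : ContDiffOn ℝ 1 f (SelfExciting.orthant d))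
    (hfν : ∀ k, Measurable fun y => ∫ z, f (y + z • SelfExciting.column B k) ∂(ν k y))
    (hφ : ∀ x ∈ S, ∀ t : ℝ≥0, 0 < t → SelfExciting.expectedJumpTerm B ν Λ f (P x) t < ⊤) :
    SelfExciting.HasTimeDependentGenerator S P Λ hΛ f (SelfExciting.generator μ B ν f) ∧
    ((∀ s t y, μ s y = μ t y) →
      f ∈ SelfExciting.extendedDomain S P Λ hΛ ∧
      SelfExciting.HasExtendedGenerator S P Λ hΛ f (SelfExciting.generator μ B ν f 0)) := by
  have main : SelfExciting.HasTimeDependentGenerator S P Λ hΛ f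
      (SelfExciting.generator μ B ν f) := by
    refine ⟨hf, SelfExciting.measurable_generator hμ B ν hf hf1, fun x hx => ?_⟩
    have h := hP x hx
    have hpath := h.ae_path hμ hf hf1 (hφ x hx)
    refine ⟨hpath.mono fun ω hω => hω.1, Locally.of_prop
      ⟨h.martingale_compensated hΛ hμ hf hf1 (hφ x hx), ?_⟩⟩
    filter_upwards [hpath, h.intensity_nonneg] with ω hω hpos
    exact SelfExciting.isCadlagPath_compensated hf1 (h.intensity_cadlag ω) hpos hω.1
  refine ⟨main, fun hμt => ?_⟩
  have heq : SelfExciting.generator μ B ν f = fun _ => SelfExciting.generator μ B ν f 0 := by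
    funext t y
    simp only [SelfExciting.generator, hμt t 0 y]
  have hgen : SelfExciting.HasExtendedGenerator S P Λ hΛ f (SelfExciting.generator μ B ν f 0) := by
    rw [heq] at main
    exact main
  exact ⟨⟨_, hgen⟩, hgen⟩
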